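/- Words over $\mathbb Z_{2^h}$ and signals. For a word $c=(c_0,\dots,c_{n-1})\in\mathbb Z_{2^h}^n$ and a fixed constant $\zeta>0$ let $$S_c(\theta)=\sum_{i=0}^{n-1}e^{2\pi\sqrt{-1}\,c_i/2^h}\,e^{2\pi\sqrt{-1}\,(i+\zeta)\theta},\qquad \mathrm{PMEPR}(c)=\frac1n\sup_{0\le\theta<1}|S_c(\theta)|^2,$$ and for a code $\mathcal C\subseteq\mathbb Z_{2^h}^n$ let $\mathrm{PMEPR}(\mathcal C)=\max_{c\in\mathcal C}\mathrm{PMEPR}(c)$ (these values do not depend on $\zeta$). For a binary code $\mathcal B\subseteq\mathbb Z_2^n$ let $E_1(\mathcal B)$ be the set of all codes $\{\sigma(b)+w : b\in\mathcal B\}\subseteq\mathbb Z_2^n$, where $\sigma$ is a permutation of $\{0,\dots,n-1\}$, $\sigma(b)=(b_{\sigma(0)},\dots,b_{\sigma(n-1)})$, and $w\in\mathbb Z_2^n$ (the case $h=1$). Let $\mathrm{RM}(r,m)\subseteq\mathbb Z_2^{2^m}$ be the binary Reed--Muller code of order $r$ and length $2^m$, that is, the set of value vectors, on the points of $\mathbb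 F_2^m$, of the polynomials over $\mathbb F_2$ in $m$ variables of total degree at most $r$. Corollary. For every fixed integer $r>1$, $$\liminf_{m\to\infty}\ \min_{\mathcal C\in E_1(\mathrm{RM}(r,m))}\mathrm{PMEPR}(\mathcal C)\ \ge\ 15\left(\sqrt2+1\right)^{2r-4}.$$ -/

import Mathlib

noncomputable section

namespace OFDM

/-- The word `ĉ` of PSK symbols, `ĉ i = exp (2 π j c_i / 2 ^ h)`, attached to a word `c` over
the integers modulo `2 ^ h`. -/
def psk (h : ℕ) {n : ℕ} (c : Fin n → ZMod (2 ^ h)) (i : Fin n) : ℂ :=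
  Complex.exp (2 * Real.pi * Complex.I * ((c i).val : ℂ) / (2 : ℂ) ^ h)

/-- The complex envelope `S_c(θ) = ∑ i, ĉ i * exp (2 π j (i + ζ) θ)`. -/
def envelope (ζ : ℝ) (h : ℕ) {n : ℕ} (c : Fin n → ZMod (2 ^ h)) (θ : ℝ) : ℂ :=
  ∑ i : Fin n, psk h c i *
    Complex.exp (2 * Real.pi * Complex.I * (((i : ℕ) : ℂ) + (ζ : ℂ)) * (θ : ℂ))

/-- The PMEPR of a word: `1 / n` times the supremum of `|S_c(θ)|²` over `0 ≤ θ < 1`. -/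
def pmepr (ζ : ℝ) (h : ℕ) {n : ℕ} (c : Fin n → ZMod (2 ^ h)) : ℝ :=
  1 / (n : ℝ) * sSup ((fun θ : ℝ => ‖envelope ζ h c θ‖ ^ 2) '' Set.Ico 0 1)

/-- The PMEPR of a code: the largest PMEPR of a codeword. -/
def codePMEPR (ζ : ℝ) (h : ℕ) {n : ℕ} (C : Set (Fin n → ZMod (2 ^ h))) : ℝ :=
  sSup (pmepr ζ h '' C)

/-- The word `2 ^ (h - 1) σ(b) + w`, where `σ(b) i = b (σ i)`. -/
def shiftedWord (h : ℕ) {n : ℕ} (σ : Equiv.Perm (Fin n)) (w : Fin n → ZMod (2 ^ h))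
    (b : Fin n → ZMod 2) : Fin n → ZMod (2 ^ h) :=
  fun i => (2 : ZMod (2 ^ h)) ^ (h - 1) * ((b (σ i)).val : ZMod (2 ^ h)) + w i

/-- `E_h(B)`, for `h ≥ 1`: all codes over the integers modulo `2 ^ h` that arise from the binary
code `B` by a permutation of the coordinates and an offset. -/
def equivalentCodes (h : ℕ) {n : ℕ} (B : Set (Fin n → ZMod 2)) :
    Set (Set (Fin n → ZMod (2 ^ h))) :=
  {C | ∃ (σ : Equiv.Perm (Fin n)) (w : Fin n → ZMod (2 ^ h)), C = shiftedWord h σ w '' B}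

/-- The least PMEPR of a code in `E_h(B)`. -/
def minPMEPR (ζ : ℝ) (h : ℕ) {n : ℕ} (B : Set (Fin n → ZMod 2)) : ℝ :=
  sInf (codePMEPR ζ h '' equivalentCodes h B)

/-- The `i`-th point of the space of binary `m`-tuples: the binary digits of `i`. -/
def binaryPoint (m : ℕ) (i : Fin (2 ^ m)) : Fin m → ZMod 2 :=
  fun k => if (i : ℕ).testBit (k : ℕ) then 1 else 0

/-- The Reed-Muller code `RM(r, m)` of length `2 ^ m`: the value vectors of the binary polynomials
in `m` variables of degree at most `r`. -/
def reedMuller (r m : ℕ) : Set (Fin (2 ^ m) → ZMod 2) :=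
  {b | ∃ p : MvPolynomial (Fin m) (ZMod 2), p.totalDegree ≤ r ∧
    ∀ i, b i = MvPolynomial.eval (binaryPoint m i) p}

end OFDM

end

/-! At `θ = 0` the envelope of a binary word is the sum of its signs. Hence the PMEPR of a code
equivalent to `RM(r, m)` is at least `1 / n` times the square of the best correlation between the
sign function of the offset (with coordinates permuted) and a polynomial of degree at most `r`. It
suffices that every sign function on binary `m`-tuples has correlation at least about `√15 (√2 + 1)
^ (r - 2) √2 ^ m` with such a polynomial; this is `Correlates`.

For `r = 2`, let `S` be the correlation of `f` with a quadratic form `M` and `n = 2 ^ m`. The sum of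
`∏ f (x i) chi (quad M (x i))` over injective `2j`-tuples is `n ^ j` times a perturbed Hermite
polynomial of degree `2j` in `S / √n` (`hermitePair_eq`). Averaging over `M` leaves only the tuples
on which all quadratic forms sum to zero (`sum_prod_chi_quad`). The even linear relations of such a
tuple form a code containing its dual. Either this code is self-dual without words of weight two, or
it is so large that the tuples in question are negligible in number. Up to length 14 every such
self-dual code is reflective (`SelfDual.reflective`): it has two mirror halves, which turn the sum
over the tuples obeying its relations into a sum of squares (`SelfDual.sum_prod_nonneg`). So the
averaged Hermite polynomials of degrees 2 to 14 are at least `-O(1 / n)`. A positive combination of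
them with constant term 3024 is, in the limit, `l - 15` times a square, where `l = S² / n`; it would
be almost nonpositive on average if `S² ≤ 15 n` held for all `M`.

For larger `r`, splitting off one variable adds the correlations for orders `r + 1` and `r` in `m`
variables (`Correlates.succ`). The resulting geometric series contributes a factor `1 / (√2 - 1) =
√2 + 1` per order. -/

noncomputable section

namespace OFDM

open Finset

/-! ### Elementary symmetric sums of signs -/

/-- The elementary symmetric sum of degree `k` of the values of `Z` on `s`. -/
def symSum {ι : Type*} (s : Finset ι) (Z : ι → ℝ) (k : ℕ) : ℝ :=
  ∑ A ∈ s.powersetCard k, ∏ i ∈ A, Z i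

lemma symSum_zero {ι : Type*} (s : Finset ι) (Z : ι → ℝ) : symSum s Z 0 = 1 := by
  simp [symSum]

lemma symSum_one {ι : Type*} (s : Finset ι) (Z : ι → ℝ) : symSum s Z 1 = ∑ i ∈ s, Z i := by
  simp [symSum, powersetCard_one]

lemma symSum_insert {ι : Type*} [DecidableEq ι] (s : Finset ι) (Z : ι → ℝ) (k : ℕ) {a : ι}
    (ha : a ∉ s) : symSum (insert a s) Z (k + 1) = symSum s Z (k + 1) + Z a * symSum s Z k := by
  unfold symSum
  rw [powersetCard_succ_insert ha, sum_union, sum_image, mul_sum]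
  · congr 1
    refine sum_congr rfl fun A hA => prod_insert fun h => ha ((mem_powersetCard.1 hA).1 h)
  · intro A hA B hB h
    have hA' : a ∉ A := fun h => ha ((mem_powersetCard.1 hA).1 h)
    have hB' : a ∉ B := fun h => ha ((mem_powersetCard.1 hB).1 h)
    rw [← erase_insert hA', ← erase_insert hB', h]
  · rw [disjoint_left]
    intro A hA hB
    obtain ⟨B, -, rfl⟩ := mem_image.1 hB
    exact ha ((mem_powersetCard.1 hA).1 (mem_insert_self _ _))

/-- The three-term recursion of the elementary symmetric sums of signs. -/
lemma symSum_rec {ι : Type*} [DecidableEq ι] (s : Finset ι) (Z : ι → ℝ)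
    (hZ : ∀ i, Z i ^ 2 = 1) (k : ℕ) :
    (k + 2) * symSum s Z (k + 2)
      = (∑ i ∈ s, Z i) * symSum s Z (k + 1) - (#s - k) * symSum s Z k := by
  induction s using Finset.induction_on generalizing k with
  | empty =>
    have h1 : symSum (∅ : Finset ι) Z (k + 2) = 0 := by
      rw [symSum, powersetCard_eq_empty.2 (by simp), sum_empty]
    rcases k with _ | k
    · simp [h1]
    · have h2 : symSum (∅ : Finset ι) Z (k + 1) = 0 := by
        rw [symSum, powersetCard_eq_empty.2 (by simp), sum_empty]
      simp [h1, h2]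
  | insert a s ha ih =>
    rw [symSum_insert s Z (k + 1) ha, symSum_insert s Z k ha, sum_insert ha, card_insert_of_notMem ha]
    rcases k with _ | k
    · have h0 := ih 0
      have hz := hZ a
      simp only [zero_add, symSum_zero, symSum_one, Nat.cast_zero] at h0 ⊢
      push_cast
      linear_combination h0 - hz
    · rw [symSum_insert s Z k ha]
      have h0 := ih (k + 1)
      have h1 := ih k
      have hz := hZ a
      push_cast at h0 h1 ⊢
      linear_combination h0 + Z a * h1 - symSum s Z (k + 1) * hz

/-- Summing a function of the image over all injective `k`-tuples. -/
lemma sum_injective_image {V : Type*} [Fintype V] [DecidableEq V] (k : ℕ) (g : Finset V → ℝ) :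
    ∑ x : Fin k → V with Function.Injective x, g (univ.image x)
      = k.factorial * ∑ A ∈ (univ : Finset V).powersetCard k, g A := by
  classical
  rw [mul_sum, ← sum_fiberwise_of_maps_to (s := univ.filter fun x : Fin k → V => Function.Injective x)
    (t := (univ : Finset V).powersetCard k) (g := fun x => univ.image x)]
  · refine sum_congr rfl fun A hA => ?_
    have hA' := (mem_powersetCard.1 hA).2
    rw [sum_congr rfl (g := fun _ => g A) (by
      intro x hx
      rw [(mem_filter.1 hx).2]), sum_const, nsmul_eq_mul]
    congr 2
    -- The injective tuples with image `A` are the bijections from `Fin k` to `A`, so each fibre has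
    -- `k!` elements.
    have e : {x // x ∈ ((univ.filter fun x : Fin k → V => Function.Injective x).filter
        fun x => univ.image x = A)} ≃ (Fin k ≃ A) :=
      { toFun := fun x => Equiv.ofBijective
          (fun i => ⟨x.1 i, by
            have h := mem_image_of_mem x.1 (mem_univ i)
            rwa [(mem_filter.1 x.2).2] at h⟩) (by
          rw [Fintype.bijective_iff_injective_and_card]
          refine ⟨fun i j h => ?_, by simp [hA']⟩
          exact (mem_filter.1 (mem_filter.1 x.2).1).2 (congrArg Subtype.val h))
        invFun := fun e => ⟨fun i => (e i : V), by
          simp only [mem_filter, mem_univ, true_and]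
          refine ⟨fun i j h => e.injective (Subtype.ext h), ?_⟩
          ext v
          simp only [mem_image, mem_univ, true_and]
          exact ⟨fun ⟨i, hi⟩ => hi ▸ (e i).2, fun hv => ⟨e.symm ⟨v, hv⟩, by simp⟩⟩⟩
        left_inv := fun x => by ext; rfl
        right_inv := fun e => by ext; rfl }
    have h := Fintype.card_congr e
    rw [Fintype.card_coe] at h
    rw [h, Fintype.card_equiv (Fintype.equivOfCardEq (by simp [hA'])), Fintype.card_fin]
  · intro x hx
    simp only [mem_filter, mem_univ, true_and] at hx
    simp [mem_powersetCard, card_image_of_injective _ hx]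

lemma sum_injective_prod {V : Type*} [Fintype V] [DecidableEq V] (k : ℕ) (Z : V → ℝ) :
    ∑ x : Fin k → V with Function.Injective x, ∏ i, Z (x i)
      = k.factorial * symSum univ Z k := by
  unfold symSum
  rw [← sum_injective_image]
  refine sum_congr rfl fun x hx => ?_
  rw [prod_image fun i _ j _ h => (mem_filter.1 hx).2 h]

/-! ### Perturbed Hermite polynomials and the test polynomial -/

/-- The normalised sums `d_{2j} / n^j` and `S d_{2j+1} / n^{j+1}`, where `d_k = k! e_k`, as
functions of `l = S² / n` and `e = 1 / n`. -/
def hermitePair (l e : ℝ) : ℕ → ℝ × ℝ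
  | 0 => (1, l)
  | j + 1 =>
    let a := (hermitePair l e j).2 - (2 * j + 1) * (1 - 2 * j * e) * (hermitePair l e j).1
    (a, l * a - (2 * j + 2) * (1 - (2 * j + 1) * e) * (hermitePair l e j).2)

/-- Multiplying `symSum_rec` by `(k + 1)!` and normalising by powers of `#s` gives the defining
recursion of `hermitePair`. At `e = 0` it is the Hermite recursion, with pairs `(He_{2j}(x), x
He_{2j+1}(x))` for `l = x²`. -/
lemma hermitePair_eq {ι : Type*} [DecidableEq ι] (s : Finset ι) (hs : s.Nonempty) (Z : ι → ℝ)
    (hZ : ∀ i, Z i ^ 2 = 1) (j : ℕ) :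
    hermitePair ((∑ i ∈ s, Z i) ^ 2 / #s) (1 / #s) j
      = ((2 * j).factorial * symSum s Z (2 * j) / #s ^ j,
        (∑ i ∈ s, Z i) * ((2 * j + 1).factorial * symSum s Z (2 * j + 1)) / #s ^ (j + 1)) := by
  have hn : (#s : ℝ) ≠ 0 := by exact_mod_cast hs.card_pos.ne'
  have hu : (#s : ℝ) * (#s : ℝ)⁻¹ = 1 := mul_inv_cancel₀ hn
  induction j with
  | zero => simp [hermitePair, symSum_zero, symSum_one, pow_two]
  | succ j ih =>
    have h1 := symSum_rec s Z hZ (2 * j)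
    have h2 := symSum_rec s Z hZ (2 * j + 1)
    have f1 : ((2 * (j + 1)).factorial : ℝ) = (2 * j + 2) * (2 * j + 1) * (2 * j).factorial := by
      rw [show 2 * (j + 1) = 2 * j + 1 + 1 by ring, Nat.factorial_succ, Nat.factorial_succ]
      push_cast; ring
    have f2 : ((2 * (j + 1) + 1).factorial : ℝ)
        = (2 * j + 3) * (2 * j + 2) * (2 * j + 1) * (2 * j).factorial := by
      rw [Nat.factorial_succ]
      push_cast [f1]; ring
    have f3 : ((2 * j + 1).factorial : ℝ) = (2 * j + 1) * (2 * j).factorial := by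
      rw [Nat.factorial_succ]; push_cast; ring
    have key : (hermitePair ((∑ i ∈ s, Z i) ^ 2 / #s) (1 / #s) j).2
        - (2 * j + 1) * (1 - 2 * j * (1 / #s))
          * (hermitePair ((∑ i ∈ s, Z i) ^ 2 / #s) (1 / #s) j).1
        = (2 * (j + 1)).factorial * symSum s Z (2 * (j + 1)) / #s ^ (j + 1) := by
      rw [ih, f1, f3, show 2 * (j + 1) = 2 * j + 2 by ring]
      push_cast at h1
      simp only [div_eq_mul_inv, pow_succ, mul_inv, one_mul]
      linear_combination (-(2 * j + 1 : ℝ) * (2 * j).factorial * ((#s : ℝ) ^ j)⁻¹ * (#s : ℝ)⁻¹) * h1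
        + ((2 * j + 1 : ℝ) * (2 * j).factorial * ((#s : ℝ) ^ j)⁻¹ * symSum s Z (2 * j)) * hu
    simp only [hermitePair, key]
    refine Prod.ext rfl ?_
    simp only
    rw [ih, f2, f1, f3, show 2 * (j + 1) + 1 = 2 * j + 1 + 2 by ring,
      show 2 * (j + 1) = 2 * j + 1 + 1 by ring]
    push_cast at h2
    simp only [div_eq_mul_inv, pow_succ, mul_inv, one_mul]
    linear_combination (-(2 * j + 1 : ℝ) * (2 * j + 2) * (2 * j).factorial * (∑ i ∈ s, Z i)
        * ((#s : ℝ) ^ j)⁻¹ * (#s : ℝ)⁻¹ * (#s : ℝ)⁻¹) * h2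
      + ((2 * j + 1 : ℝ) * (2 * j + 2) * (2 * j).factorial * (∑ i ∈ s, Z i)
        * ((#s : ℝ) ^ j)⁻¹ * (#s : ℝ)⁻¹ * symSum s Z (2 * j + 1)) * hu

lemma continuous_hermitePair (j : ℕ) :
    Continuous fun p : ℝ × ℝ => hermitePair p.1 p.2 j := by
  induction j with
  | zero => simp only [hermitePair]; fun_prop
  | succ j ih =>
    simp only [hermitePair]
    fun_prop

/-- A nonnegative combination of Hermite polynomials with positive constant term that is
nonpositive for `x² ≤ 15`, in its perturbed form. -/
def testSum (l e : ℝ) : ℝ :=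
  (hermitePair l e 7).1 + 58 * (hermitePair l e 6).1 + 1206 * (hermitePair l e 5).1
    + 11244 * (hermitePair l e 4).1 + 48036 * (hermitePair l e 3).1
    + 85320 * (hermitePair l e 2).1 + 47304 * (hermitePair l e 1).1 + 3024

/-- The coefficients of `testSum` are the Hermite expansion of the right-hand side in `x = √l`; the
constant 3024 is its mean under the standard Gaussian law. -/
lemma testSum_zero (l : ℝ) : testSum l 0 = (l - 15) * (l ^ 3 - 9 * l ^ 2 + 15 * l - 3) ^ 2 := by
  simp only [testSum, hermitePair]
  push_cast
  ring

lemma continuous_testSum : Continuous fun p : ℝ × ℝ => testSum p.1 p.2 := by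
  have := continuous_hermitePair
  unfold testSum
  fun_prop

lemma exists_testSum_le : ∃ e₀ > 0, ∀ e, 0 ≤ e → e ≤ e₀ → ∀ l, 0 ≤ l → l ≤ 15 →
    testSum l e ≤ 1000 := by
  have hc : IsCompact (Set.Icc (0 : ℝ) 15 ×ˢ Set.Icc (0 : ℝ) 1) := isCompact_Icc.prod isCompact_Icc
  have hu := hc.uniformContinuousOn_of_continuous continuous_testSum.continuousOn
  -- Any tolerance safely below 3024 would do, since the later contradiction compares it with 3024
  -- minus a small error.
  obtain ⟨d, hd, h⟩ := Metric.uniformContinuousOn_iff.1 hu 1000 (by norm_num)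
  refine ⟨min (d / 2) 1, by positivity, fun e he he' l hl hl' => ?_⟩
  have h1 := h (l, e) ⟨⟨hl, hl'⟩, ⟨he, he'.trans (min_le_right _ _)⟩⟩ (l, 0)
    ⟨⟨hl, hl'⟩, ⟨le_rfl, zero_le_one⟩⟩ (by
      have := he'.trans (min_le_left _ _)
      rw [Prod.dist_eq]
      simp only [dist_self, Real.dist_eq, sub_zero, abs_of_nonneg he]
      rw [max_lt_iff]
      constructor <;> linarith)
  rw [Real.dist_eq] at h1
  have h2 := (abs_lt.1 h1).2
  simp only [testSum_zero] at h2
  have h3 : (l - 15) * (l ^ 3 - 9 * l ^ 2 + 15 * l - 3) ^ 2 ≤ 0 :=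
    mul_nonpos_of_nonpos_of_nonneg (by linarith) (sq_nonneg _)
  linarith

/-! ### Parity of intersections and words of weight four -/

section Parity

variable {ι : Type*} [DecidableEq ι]

lemma card_symmDiff_inter (s t u : Finset ι) :
    #(symmDiff s t ∩ u) + 2 * #(s ∩ t ∩ u) = #(s ∩ u) + #(t ∩ u) := by
  have h : symmDiff s t ∩ u = symmDiff (s ∩ u) (t ∩ u) := by
    ext a; simp only [mem_inter, mem_symmDiff]; tauto
  have h1 : symmDiff (s ∩ u) (t ∩ u) = ((s ∩ u) ∪ (t ∩ u)) \ ((s ∩ u) ∩ (t ∩ u)) := by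
    ext a; simp only [mem_inter, mem_symmDiff, mem_sdiff, mem_union]; tauto
  have h2 := card_union_add_card_inter (s ∩ u) (t ∩ u)
  have h3 : s ∩ t ∩ u = (s ∩ u) ∩ (t ∩ u) := by
    ext a; simp only [mem_inter]; tauto
  have h4 : (s ∩ u) ∩ (t ∩ u) ⊆ (s ∩ u) ∪ (t ∩ u) := inter_subset_union
  have h5 := card_sdiff_add_card_eq_card h4
  rw [h, h1, h3]
  omega

lemma even_card_symmDiff_inter (s t u : Finset ι) :
    Even #(symmDiff s t ∩ u) ↔ (Even #(s ∩ u) ↔ Even #(t ∩ u)) := by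
  have := card_symmDiff_inter s t u
  rw [← Nat.even_add, ← this, Nat.even_add]
  simp

lemma card_symmDiff_add (s t : Finset ι) : #(symmDiff s t) + 2 * #(s ∩ t) = #s + #t := by
  have h := card_symmDiff_inter s t (s ∪ t)
  have h1 : symmDiff s t ∩ (s ∪ t) = symmDiff s t := by
    ext a; simp only [mem_inter, mem_symmDiff, mem_union]; tauto
  have h2 : s ∩ t ∩ (s ∪ t) = s ∩ t := by
    ext a; simp only [mem_inter, mem_union]; tauto
  rwa [h1, h2, inter_eq_left.2 subset_union_left, inter_eq_left.2 subset_union_right] at h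

lemma prod_sign_eq (A s : Finset ι) :
    ∏ j ∈ A, (if j ∈ s then (-1 : ℝ) else 1) = (-1) ^ #(A ∩ s) := by
  rw [prod_ite, prod_const, prod_const_one, mul_one, filter_mem_eq_inter]

/-- The words of weight four through a coordinate. -/
def blocks (C : Finset (Finset ι)) (i : ι) : Finset (Finset ι) := {s ∈ C | i ∈ s ∧ #s = 4}

lemma mem_blocks {C : Finset (Finset ι)} {i : ι} {s : Finset ι} : s ∈ blocks C i ↔ s ∈ C ∧ i ∈ s ∧ #s = 4 := by
  simp [blocks]

lemma mem_blocks_of_mem {C : Finset (Finset ι)} {i j : ι} {B : Finset ι} (hB : B ∈ blocks C i) (hj : j ∈ B) :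
    B ∈ blocks C j := by
  rw [mem_blocks] at hB ⊢
  exact ⟨hB.1, hj, hB.2.2⟩

end Parity

/-! ### Weight counts in self-dual codes -/

/-- A binary self-dual code without words of weight two, as a family of supports. -/
structure SelfDual {ι : Type*} [Fintype ι] [DecidableEq ι] (C : Finset (Finset ι)) (k : ℕ) :
    Prop where
  mem_iff : ∀ s, s ∈ C ↔ ∀ t ∈ C, Even #(s ∩ t)
  card_index : Fintype.card ι = 2 * k
  card_eq : #C = 2 ^ k
  dist : ∀ s ∈ C, #s ≠ 2

namespace SelfDual

variable {ι : Type*} [Fintype ι] [DecidableEq ι] {C : Finset (Finset ι)} {k : ℕ}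

lemma even_inter (h : SelfDual C k) {s t : Finset ι} (hs : s ∈ C) (ht : t ∈ C) :
    Even #(s ∩ t) := (h.mem_iff s).1 hs t ht

lemma even_card (h : SelfDual C k) {s : Finset ι} (hs : s ∈ C) : Even #s := by
  simpa using h.even_inter hs hs

lemma symmDiff_mem (h : SelfDual C k) {s t : Finset ι} (hs : s ∈ C) (ht : t ∈ C) :
    symmDiff s t ∈ C := by
  rw [h.mem_iff]
  intro u hu
  rw [even_card_symmDiff_inter]
  simp [h.even_inter hs hu, h.even_inter ht hu]

lemma symmDiff_mem_iff (h : SelfDual C k) {s t : Finset ι} (ht : t ∈ C) :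
    symmDiff s t ∈ C ↔ s ∈ C :=
  ⟨fun hs => by simpa using h.symmDiff_mem hs ht, fun hs => h.symmDiff_mem hs ht⟩

lemma univ_mem (h : SelfDual C k) : univ ∈ C := by
  rw [h.mem_iff]
  intro t ht
  simpa using h.even_card ht

lemma empty_mem (h : SelfDual C k) : ∅ ∈ C := by
  rw [h.mem_iff]
  intro t ht
  simp

lemma compl_mem (h : SelfDual C k) {s : Finset ι} (hs : s ∈ C) : sᶜ ∈ C := by
  have := h.symmDiff_mem hs h.univ_mem
  rwa [← Finset.top_eq_univ, symmDiff_top] at this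

lemma card_ne (h : SelfDual C k) {s : Finset ι} (hs : s ∈ C) : #s + 2 ≠ 2 * k := by
  intro h1
  refine h.dist _ (h.compl_mem hs) ?_
  rw [card_compl, h.card_index]
  omega

lemma card_le (h : SelfDual C k) (s : Finset ι) : #s ≤ 2 * k := by
  rw [← h.card_index]
  exact card_le_univ s

lemma eq_univ (h : SelfDual C k) {s : Finset ι} (hs : #s = 2 * k) : s = univ := by
  rw [← card_eq_iff_eq_univ, hs, h.card_index]

/-- Orthogonality of characters: if `A` is not in the code, it meets some word `t` oddly, and adding
`t` permutes the code while flipping every sign. -/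
lemma sum_sign (h : SelfDual C k) (A : Finset ι) :
    ∑ s ∈ C, (-1 : ℝ) ^ #(A ∩ s) = if A ∈ C then 2 ^ k else 0 := by
  split_ifs with hA
  · rw [sum_congr rfl (g := fun _ => (1 : ℝ)) fun s hs => (h.even_inter hA hs).neg_one_pow]
    simp [h.card_eq]
  · rw [h.mem_iff] at hA
    push Not at hA
    obtain ⟨t, ht, hodd⟩ := hA
    have key : ∑ s ∈ C, (-1 : ℝ) ^ #(A ∩ s) = ∑ s ∈ C, -(-1 : ℝ) ^ #(A ∩ s) := by
      refine sum_nbij' (fun s => symmDiff s t) (fun s => symmDiff s t)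
        (fun s hs => h.symmDiff_mem hs ht) (fun s hs => h.symmDiff_mem hs ht)
        (fun s _ => by simp) (fun s _ => by simp) fun s hs => ?_
      have h1 := card_symmDiff_inter s t A
      rw [inter_comm s A, inter_comm t A, inter_comm _ A] at h1
      have h2 : (-1 : ℝ) ^ (#(A ∩ symmDiff s t) + 2 * #(s ∩ t ∩ A)) = (-1) ^ #(A ∩ symmDiff s t) := by
        rw [pow_add, pow_mul]; simp
      have h3 : (-1 : ℝ) ^ #(A ∩ t) = -1 := (Nat.not_even_iff_odd.1 hodd).neg_one_pow
      rw [← h2, h1, pow_add, h3]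
      ring
    rw [sum_neg_distrib] at key
    linarith

lemma sum_sign_mem (h : SelfDual C k) {i : ι} {A : Finset ι} (hi : i ∉ A) :
    2 * ∑ s ∈ C with i ∈ s, (-1 : ℝ) ^ #(A ∩ s)
      = (if A ∈ C then 2 ^ k else 0) - if insert i A ∈ C then 2 ^ k else 0 := by
  rw [← h.sum_sign A, ← h.sum_sign (insert i A), ← sum_sub_distrib, sum_filter, mul_sum]
  refine sum_congr rfl fun s _ => ?_
  split_ifs with his
  · rw [insert_inter_of_mem his, card_insert_of_notMem (fun h => hi (mem_inter.1 h).1)]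
    ring
  · rw [insert_inter_of_notMem his]
    ring

lemma card_blocks (i : ι) :
    #{A ∈ ({i}ᶜ : Finset ι).powersetCard 3 | insert i A ∈ C} = #(blocks C i) := by
  refine card_nbij' (fun A => insert i A) (fun s => s.erase i) ?_ ?_ ?_ ?_
  · intro A hA
    simp only [coe_filter, mem_powersetCard, Set.mem_ofPred_eq] at hA
    have hi : i ∉ A := fun h => by simpa using hA.1.1 h
    simp [mem_blocks, hA.2, card_insert_of_notMem hi, hA.1.2]
  · intro s hs
    simp only [mem_coe, mem_blocks] at hs
    simp only [coe_filter, mem_powersetCard, Set.mem_ofPred_eq, insert_erase hs.2.1, hs.1, and_true,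
      card_erase_of_mem hs.2.1, hs.2.2]
    intro j hj
    simpa using (mem_erase.1 hj).1
  · intro A hA
    simp only [coe_filter, mem_powersetCard, Set.mem_ofPred_eq] at hA
    exact erase_insert fun h => by simpa using hA.1.1 h
  · intro s hs
    exact insert_erase (mem_blocks.1 hs).2.1

/-- MacWilliams-type moment identities. For a word `s` through `i`, the signs at the other
coordinates sum to `Y = 2k + 3 - 2 #s`. The symmetric sums of these signs of degrees 1 and 2 cancel
over such words because there are no words of odd weight or of weight two, and the one of degree 3
counts the blocks through `i`. -/
lemma sum_cubic (h : SelfDual C (k + 1)) (i : ι) (p q r t : ℝ) :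
    ∑ s ∈ C with i ∈ s, (p + q * (2 * k + 3 - 2 * #s) + r * (2 * k + 3 - 2 * #s) ^ 2
      + t * (2 * k + 3 - 2 * #s) ^ 3)
      = 2 ^ k * (p + r * (2 * k + 1) - 6 * t * #(blocks C i)) := by
  set Z : Finset ι → ι → ℝ := fun s j => if j ∈ s then -1 else 1 with hZ
  have hZ2 : ∀ s j, Z s j ^ 2 = 1 := fun s j => by simp only [hZ]; split_ifs <;> norm_num
  have hN : (#({i}ᶜ : Finset ι) : ℝ) = 2 * k + 1 := by
    rw [card_compl, h.card_index, card_singleton]; 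
    rw [show 2 * (k + 1) - 1 = 2 * k + 1 by omega]; push_cast; ring
  have hY : ∀ s ∈ C.filter (i ∈ ·), ∑ j ∈ ({i}ᶜ : Finset ι), Z s j = 2 * k + 3 - 2 * #s := by
    intro s hs
    have h1 : ∑ j, Z s j = 2 * (k + 1) - 2 * #s := by
      have : ∀ j, Z s j = 1 - 2 * (if j ∈ s then 1 else 0) := fun j => by
        simp only [hZ]; split_ifs <;> norm_num
      simp only [this, sum_sub_distrib, ← mul_sum, sum_boole, filter_univ_mem]
      simp [h.card_index]
    have h2 : Z s i = -1 := by simp [hZ, (mem_filter.1 hs).2]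
    have h3 := sum_compl_add_sum ({i} : Finset ι) (Z s)
    rw [sum_singleton, h1, h2] at h3
    linarith
  have hodd : ∀ A : Finset ι, Odd #A → A ∉ C := fun A hA hAC =>
    (Nat.not_even_iff_odd.2 hA) (h.even_card hAC)
  have hsum : ∀ m, 2 * ∑ s ∈ C with i ∈ s, symSum ({i}ᶜ : Finset ι) (Z s) m
      = ∑ A ∈ ({i}ᶜ : Finset ι).powersetCard m, ((if A ∈ C then (2 : ℝ) ^ (k + 1) else 0)
        - if insert i A ∈ C then 2 ^ (k + 1) else 0) := by
    intro m
    unfold symSum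
    rw [sum_comm, mul_sum]
    refine sum_congr rfl fun A hA => ?_
    have hi : i ∉ A := fun h => by simpa using (mem_powersetCard.1 hA).1 h
    rw [← h.sum_sign_mem hi]
    simp only [hZ, prod_sign_eq]
  have hcard : ∀ m, ∀ A ∈ ({i}ᶜ : Finset ι).powersetCard m, #A = m ∧ #(insert i A) = m + 1 := by
    intro m A hA
    have hi : i ∉ A := fun h => by simpa using (mem_powersetCard.1 hA).1 h
    rw [card_insert_of_notMem hi, (mem_powersetCard.1 hA).2]
    simp
  have s0 : ∑ s ∈ C with i ∈ s, (1 : ℝ) = 2 ^ k := by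
    have := hsum 0
    simp only [symSum_zero, powersetCard_zero, sum_singleton, h.empty_mem, if_true] at this
    rw [if_neg (hodd _ (by simp))] at this
    rw [pow_succ] at this
    linarith
  have s1 : ∑ s ∈ C with i ∈ s, symSum ({i}ᶜ : Finset ι) (Z s) 1 = 0 := by
    have := hsum 1
    rw [sum_eq_zero (s := powersetCard _ _)] at this
    · linarith
    · intro A hA
      rw [if_neg (hodd A (by simp [(hcard 1 A hA).1])),
        if_neg (fun h' => h.dist _ h' (hcard 1 A hA).2), sub_zero]
  have s2 : ∑ s ∈ C with i ∈ s, symSum ({i}ᶜ : Finset ι) (Z s) 2 = 0 := by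
    have := hsum 2
    rw [sum_eq_zero (s := powersetCard _ _)] at this
    · linarith
    · intro A hA
      rw [if_neg (fun h' => h.dist _ h' (hcard 2 A hA).1),
        if_neg (hodd _ (by rw [(hcard 2 A hA).2]; decide)), sub_zero]
  have s3 : ∑ s ∈ C with i ∈ s, symSum ({i}ᶜ : Finset ι) (Z s) 3 = - 2 ^ k * #(blocks C i) := by
    have := hsum 3
    rw [sum_congr (s₁ := powersetCard _ _) rfl (g := fun A => -(if insert i A ∈ C then (2 : ℝ) ^ (k + 1) else 0)) (by
      intro A hA
      rw [if_neg (hodd A (by rw [(hcard 3 A hA).1]; decide)), zero_sub]), sum_neg_distrib,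
      ← sum_filter, sum_const, card_blocks, nsmul_eq_mul, pow_succ] at this
    linarith
  -- With `2k + 1` signs, `Y² = (2k + 1) + 2 e₂` and `Y³ = (6k + 1) e₁ + 6 e₃`.
  have e : ∀ s ∈ C.filter (i ∈ ·), p + q * (2 * k + 3 - 2 * #s) + r * (2 * k + 3 - 2 * #s) ^ 2
      + t * (2 * k + 3 - 2 * #s) ^ 3
      = (p + r * (2 * k + 1)) * 1
        + (q + t * (6 * k + 1)) * symSum ({i}ᶜ : Finset ι) (Z s) 1
        + 2 * r * symSum ({i}ᶜ : Finset ι) (Z s) 2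
        + 6 * t * symSum ({i}ᶜ : Finset ι) (Z s) 3 := by
    intro s hs
    have h0 := symSum_rec ({i}ᶜ : Finset ι) (Z s) (hZ2 s) 0
    have h1 := symSum_rec ({i}ᶜ : Finset ι) (Z s) (hZ2 s) 1
    have h2 := symSum_one ({i}ᶜ : Finset ι) (Z s)
    rw [hY s hs] at h0 h1 h2
    simp only [zero_add, symSum_zero, Nat.cast_zero, Nat.cast_one, Nat.reduceAdd, hN] at h0 h1
    rw [h2] at h0 h1 ⊢
    linear_combination (-r - t * (2 * k + 3 - 2 * #s)) * h0 - 2 * t * h1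
  rw [sum_congr rfl e]
  simp only [sum_add_distrib, ← mul_sum, s0, s1, s2, s3]
  ring

lemma sum_ite_card (h : SelfDual C k) (hk : k ≠ 2) (i : ι) (x y : ℝ) :
    ∑ s ∈ C with i ∈ s, (if #s = 4 then x else if #s = 2 * k then y else 0)
      = #(blocks C i) * x + y := by
  have e : ∀ s ∈ C.filter (i ∈ ·), (if #s = 4 then x else if #s = 2 * k then y else 0)
      = (if #s = 4 then x else 0) + if s = univ then y else 0 := by
    intro s hs
    by_cases h4 : #s = 4
    · have : s ≠ univ := by
        rintro rfl
        rw [card_univ, h.card_index] at h4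
        omega
      simp [h4, this]
    · by_cases hu : s = univ
      · subst hu
        simp [h.card_index, show ¬ 2 * k = 4 by omega]
      · simp [h4, hu, show ¬ #s = 2 * k from fun h' => hu (h.eq_univ h')]
  rw [sum_congr rfl e, sum_add_distrib, ← sum_filter, sum_const, nsmul_eq_mul, filter_filter]
  congr 1
  rw [sum_ite_eq_of_mem']
  simp [h.univ_mem]

lemma four_le_of_mem (h : SelfDual C k) {i : ι} {s : Finset ι} (hs : s ∈ C) (hi : i ∈ s) :
    4 ≤ #s := by
  have h1 := h.even_card hs
  have h2 := h.dist s hs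
  have h3 := card_pos.2 ⟨i, hi⟩
  obtain ⟨m, hm⟩ := h1
  omega

lemma card_mem_cases (h : SelfDual C k) {i : ι} {s : Finset ι} (hs : s ∈ C) (hi : i ∈ s) :
    #s = 2 * k ∨ (4 ≤ #s ∧ #s + 4 ≤ 2 * k) := by
  have h1 := h.even_card hs
  have h2 := h.four_le_of_mem hs hi
  have h3 := h.card_le s
  have h4 := h.card_ne hs
  obtain ⟨m, hm⟩ := h1
  omega

/-- In shorter codes the full word is the only one through `i`, while half of all words pass through
`i`; this forces length two, where the full word has weight two. -/
lemma four_le_length (h : SelfDual C k) (i : ι) : 4 ≤ k := by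
  have hk : 1 ≤ k := by
    have := Fintype.card_pos_iff.2 ⟨i⟩
    have := h.card_index
    omega
  obtain ⟨k, rfl⟩ : ∃ l, k = l + 1 := ⟨k - 1, by omega⟩
  by_contra! hlt
  have h1 := h.sum_cubic i 1 0 0 0
  have h2 : C.filter (i ∈ ·) ⊆ {univ} := by
    intro s hs
    rw [mem_filter] at hs
    rcases h.card_mem_cases hs.1 hs.2 with h3 | h3
    · simp [h.eq_univ h3]
    · omega
  have h3 := card_le_card h2
  simp only [zero_mul, add_zero, mul_zero, sub_zero, mul_one, sum_const, nsmul_eq_mul] at h1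
  have h4 : #(C.filter (i ∈ ·)) = 2 ^ k := by exact_mod_cast h1
  rw [card_singleton, h4] at h3
  have h5 : k = 0 := by
    by_contra h0
    have := Nat.one_lt_two_pow h0
    omega
  subst h5
  exact h.dist _ h.univ_mem (by rw [card_univ, h.card_index])

/-- Only the weights 4 and 8 occur through `i`, with `Y = 1` and `Y = -7`, so the linear moment
determines the count. The next lemmas use polynomials in `Y` that vanish at all weights strictly
between 4 and the length. -/
lemma card_blocks_four (h : SelfDual C 4) (i : ι) : #(blocks C i) = 7 := by
  have h1 := h.sum_cubic i 0 1 0 0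
  rw [sum_congr rfl (g := fun s => if #s = 4 then (1 : ℝ) else if #s = 2 * 4 then -7 else 0) (by
    intro s hs
    rw [mem_filter] at hs
    rcases h.card_mem_cases hs.1 hs.2 with h3 | h3
    · rw [h3]; norm_num
    · rw [show #s = 4 by omega]; norm_num), h.sum_ite_card (by norm_num)] at h1
  norm_num at h1
  have : (#(blocks C i) : ℝ) = 7 := by linarith
  exact_mod_cast this

lemma even_cases {m n : ℕ} (hm : Even m) (h1 : 4 ≤ m) (h2 : m + 4 ≤ n) (hn : n ≤ 14) :
    m = 4 ∨ m = 6 ∨ m = 8 ∨ m = 10 := by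
  obtain ⟨l, hl⟩ := hm
  omega

lemma card_blocks_five (h : SelfDual C 5) (i : ι) : #(blocks C i) = 6 := by
  -- The polynomial `Y + 1` vanishes at weight 6.
  have h1 := h.sum_cubic i 1 1 0 0
  rw [sum_congr rfl (g := fun s => if #s = 4 then (4 : ℝ) else if #s = 2 * 5 then -8 else 0) (by
    intro s hs
    rw [mem_filter] at hs
    rcases h.card_mem_cases hs.1 hs.2 with h3 | h3
    · rw [h3]; norm_num
    · rcases even_cases (h.even_card hs.1) h3.1 h3.2 (by norm_num) with h4 | h4 | h4 | h4 <;>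
        first | (exfalso; omega) | (rw [h4]; norm_num)), h.sum_ite_card (by norm_num)] at h1
  norm_num at h1
  have : (#(blocks C i) : ℝ) = 6 := by linarith
  exact_mod_cast this

lemma card_blocks_six (h : SelfDual C 6) (i : ι) : #(blocks C i) = 5 := by
  -- The polynomial `(Y - 1)(Y + 3)` vanishes at weights 6 and 8.
  have h1 := h.sum_cubic i (-3) 2 1 0
  rw [sum_congr rfl (g := fun s => if #s = 4 then (32 : ℝ) else if #s = 2 * 6 then 96 else 0) (by
    intro s hs
    rw [mem_filter] at hs
    rcases h.card_mem_cases hs.1 hs.2 with h3 | h3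
    · rw [h3]; norm_num
    · rcases even_cases (h.even_card hs.1) h3.1 h3.2 (by norm_num) with h4 | h4 | h4 | h4 <;>
        first | (exfalso; omega) | (rw [h4]; norm_num)), h.sum_ite_card (by norm_num)] at h1
  norm_num at h1
  have : (#(blocks C i) : ℝ) = 5 := by linarith
  exact_mod_cast this

lemma card_blocks_seven (h : SelfDual C 7) (i : ι) : #(blocks C i) = 4 := by
  -- The polynomial `(Y - 3)(Y + 1)(Y + 5)` vanishes at weights 6, 8 and 10.
  have h1 := h.sum_cubic i (-15) (-13) 3 1
  rw [sum_congr rfl (g := fun s => if #s = 4 then (384 : ℝ) else if #s = 2 * 7 then -1536 else 0) (by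
    intro s hs
    rw [mem_filter] at hs
    rcases h.card_mem_cases hs.1 hs.2 with h3 | h3
    · rw [h3]; norm_num
    · rcases even_cases (h.even_card hs.1) h3.1 h3.2 (by norm_num) with h4 | h4 | h4 | h4 <;>
        (rw [h4]; norm_num)), h.sum_ite_card (by norm_num)] at h1
  norm_num at h1
  have : (#(blocks C i) : ℝ) = 4 := by linarith
  exact_mod_cast this

end SelfDual

/-! ### Reflective codes and the geometry of blocks -/

/-- A code whose coordinates split into two halves that are mirror images of each other, in such
a way that sums over the words of the dual positions become sums of squares. -/
def Reflective {ι : Type*} [DecidableEq ι] (C : Finset (Finset ι)) : Prop :=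
  ∃ (κ : Type) (_ : Fintype κ) (_ : DecidableEq κ) (e : κ ⊕ κ ≃ ι), ∀ u : Finset κ,
    (∀ w : Finset κ, w.image (e ∘ Sum.inl) ∈ C → Even #(u ∩ w)) →
      u.image (e ∘ Sum.inl) ∪ u.image (e ∘ Sum.inr) ∈ C

namespace SelfDual

variable {ι : Type*} [Fintype ι] [DecidableEq ι] {C : Finset (Finset ι)} {k : ℕ}

lemma card_inter_blocks (h : SelfDual C k) {i : ι} {A B : Finset ι} (hA : A ∈ blocks C i)
    (hB : B ∈ blocks C i) (hAB : A ≠ B) : #(A ∩ B) = 2 := by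
  rw [mem_blocks] at hA hB
  have h1 := h.even_inter hA.1 hB.1
  have h2 : 0 < #(A ∩ B) := card_pos.2 ⟨i, mem_inter.2 ⟨hA.2.1, hB.2.1⟩⟩
  have h3 : #(A ∩ B) < 4 := by
    rw [← hA.2.2]
    refine card_lt_card (inter_subset_left.ssubset_of_ne fun h4 => hAB ?_)
    exact eq_of_subset_of_card_le (inter_eq_left.1 h4) (by rw [hA.2.2, hB.2.2])
  obtain ⟨m, hm⟩ := h1
  omega

lemma symmDiff_mem_blocks (h : SelfDual C k) {i j : ι} {A B : Finset ι} (hA : A ∈ blocks C i)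
    (hB : B ∈ blocks C i) (hjA : j ∉ A) (hjB : j ∈ B) : symmDiff A B ∈ blocks C j := by
  have h1 := h.card_inter_blocks hA hB (by rintro rfl; exact hjA hjB)
  have h2 := card_symmDiff_add A B
  rw [mem_blocks] at hA hB ⊢
  refine ⟨h.symmDiff_mem hA.1 hB.1, mem_symmDiff.2 (Or.inr ⟨hjB, hjA⟩), ?_⟩
  have := hA.2.2
  have := hB.2.2
  omega

/-- Each block through both `i` and `j` yields a second block through `j` by adding `A`; the new one
avoids `i`, so the two families are disjoint. -/
lemma two_mul_le_card_blocks (h : SelfDual C k) {i j : ι} {A : Finset ι} (hA : A ∈ blocks C i)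
    (hj : j ∉ A) : 2 * #{B ∈ blocks C i | j ∈ B} ≤ #(blocks C j) := by
  set T := {B ∈ blocks C i | j ∈ B} with hT
  have hi : ∀ B ∈ T, i ∈ B := fun B hB => (mem_blocks.1 (mem_filter.1 hB).1).2.1
  have hd : Disjoint T (T.image (symmDiff A)) := by
    rw [disjoint_left]
    intro B hB hB'
    obtain ⟨D, hD, rfl⟩ := mem_image.1 hB'
    have := hi _ hB
    rw [mem_symmDiff] at this
    have h1 := hi _ hD
    have h2 := (mem_blocks.1 hA).2.1
    tauto
  have hs : T ∪ T.image (symmDiff A) ⊆ blocks C j := by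
    intro B hB
    rcases mem_union.1 hB with hB | hB
    · exact mem_blocks_of_mem (mem_filter.1 hB).1 (mem_filter.1 hB).2
    · obtain ⟨D, hD, rfl⟩ := mem_image.1 hB
      exact h.symmDiff_mem_blocks hA (mem_filter.1 hD).1 hj (mem_filter.1 hD).2
  have h1 := card_le_card hs
  rw [card_union_of_disjoint hd, card_image_of_injective _ (symmDiff_right_injective A)] at h1
  omega

/-- Pigeonhole: fix a block `A` through `i`. At least four other blocks meet `A` in one of its three
remaining points, so two of them share such a point. -/
lemma exists_common_point (h : SelfDual C k) {i : ι} (hb : 5 ≤ #(blocks C i)) :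
    ∃ j, j ≠ i ∧ 3 ≤ #{B ∈ blocks C i | j ∈ B} := by
  by_contra! hlt
  obtain ⟨A, hA⟩ : (blocks C i).Nonempty := card_pos.1 (by omega)
  have hsub : (blocks C i).erase A ⊆ (A.erase i).biUnion fun j =>
      {B ∈ blocks C i | j ∈ B}.erase A := by
    intro B hB
    rw [mem_erase] at hB
    have h1 := h.card_inter_blocks hA hB.2 hB.1.symm
    have h2 : 1 < #(A ∩ B) := by omega
    obtain ⟨j, hj, hji⟩ := exists_mem_ne h2 i
    rw [mem_inter] at hj
    simp only [mem_biUnion, mem_erase, mem_filter]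
    exact ⟨j, ⟨hji, hj.1⟩, hB.1, hB.2, hj.2⟩
  have h1 := card_le_card hsub
  have h2 := card_biUnion_le_card_mul (A.erase i) (fun j => {B ∈ blocks C i | j ∈ B}.erase A) 1 (by
    intro j hj
    rw [mem_erase] at hj
    have := hlt j hj.1
    rw [card_erase_of_mem (mem_filter.2 ⟨hA, hj.2⟩)]
    omega)
  rw [mem_blocks] at hA
  rw [card_erase_of_mem hA.2.1, hA.2.2] at h2
  rw [card_erase_of_mem (mem_blocks.2 hA)] at h1
  omega

/-- Sixteen words pass through `i`, but only 12 can exist: the full word, six blocks, and at most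
five words of weight 6. Adding a fixed block `B` to the complement of a word of weight 6 gives a
block other than `B`, because weight 8 is excluded. -/
lemma not_five (h : SelfDual C 5) (i : ι) : False := by
  have h6 := h.card_blocks_five i
  obtain ⟨B, hB⟩ : (blocks C i).Nonempty := card_pos.1 (by omega)
  have hB' := mem_blocks.1 hB
  have h16 : #(C.filter (i ∈ ·)) = 16 := by
    have h1 := h.sum_cubic (k := 4) i 1 0 0 0
    simp only [zero_mul, add_zero, mul_zero, sub_zero, mul_one, sum_const, nsmul_eq_mul] at h1
    have : (#(C.filter (i ∈ ·)) : ℝ) = 16 := by rw [h1]; norm_num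
    exact_mod_cast this
  have hsub : C.filter (i ∈ ·) ⊆ insert univ (blocks C i ∪
      ((blocks C i).erase B).image fun A => (symmDiff A B)ᶜ) := by
    intro s hs
    rw [mem_filter] at hs
    rcases h.card_mem_cases hs.1 hs.2 with h1 | h1
    · simp [h.eq_univ h1]
    rw [mem_insert, mem_union]
    by_cases h4 : #s = 4
    · exact Or.inr (Or.inl (mem_blocks.2 ⟨hs.1, hs.2, h4⟩))
    refine Or.inr (Or.inr (mem_image.2 ⟨symmDiff sᶜ B, ?_, by simp⟩))
    have hsc := h.compl_mem hs.1
    have hi : i ∉ sᶜ := by simpa using hs.2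
    have hsd := h.symmDiff_mem hsc hB'.1
    have himem : i ∈ symmDiff sᶜ B := mem_symmDiff.2 (Or.inr ⟨hB'.2.1, hi⟩)
    have hsc4 : #sᶜ = 4 := by
      rw [card_compl, h.card_index]
      obtain ⟨m, hm⟩ := h.even_card hs.1
      omega
    have hne : sᶜ ≠ ∅ := by rw [← card_pos.trans nonempty_iff_ne_empty |>.eq]; omega
    have hadd := card_symmDiff_add sᶜ B
    have hcases := h.card_mem_cases hsd himem
    have hev := h.even_inter hsc hB'.1
    have h8 := h.card_ne hsd
    rw [mem_erase]
    refine ⟨fun h' => hne (by simpa using h'), mem_blocks.2 ⟨hsd, himem, ?_⟩⟩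
    have := hB'.2.2
    obtain ⟨m, hm⟩ := hev
    omega
  have h1 := card_le_card hsub
  have h2 := card_insert_le (univ : Finset ι) (blocks C i ∪
      ((blocks C i).erase B).image fun A => (symmDiff A B)ᶜ)
  have h3 := card_union_le (blocks C i) (((blocks C i).erase B).image fun A => (symmDiff A B)ᶜ)
  have h4 := card_image_le (s := (blocks C i).erase B) (f := fun A => (symmDiff A B)ᶜ)
  rw [card_erase_of_mem hB] at h4
  omega

end SelfDual

/-! ### Generators of the dual of one half, and doubled words -/

lemma exists_generators_pairs_two : ∀ u : Finset (Fin 2 × Bool),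
    Even #(u ∩ {(0, true), (0, false), (1, true), (1, false)}) →
    ∃ a b c : Bool, u = symmDiff (symmDiff (cond a {(0, true), (0, false)} ∅)
      (cond b {(1, true), (1, false)} ∅)) (cond c (univ.image fun m => (m, true)) ∅) := by
  decide

-- Two independent parity checks on six points leave a space of dimension four, spanned by the three
-- pairs and one transversal.
set_option maxRecDepth 10000 in
lemma exists_generators_pairs_three : ∀ u : Finset (Fin 3 × Bool),
    Even #(u ∩ {(0, true), (0, false), (1, true), (1, false)}) →
    Even #(u ∩ {(0, true), (0, false), (2, true), (2, false)}) →
    ∃ a b c d : Bool, u = symmDiff (symmDiff (cond a {(0, true), (0, false)} ∅)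
      (cond b {(1, true), (1, false)} ∅)) (symmDiff (cond c {(2, true), (2, false)} ∅)
      (cond d (univ.image fun m => (m, true)) ∅)) := by
  decide

-- The three checks generate the simplex code of length seven; its dual, the Hamming code, is
-- spanned by them and the full word.
set_option maxRecDepth 10000 in
lemma exists_generators_fano : ∀ u : Finset (Fin 7),
    Even #(u ∩ {0, 1, 2, 3}) → Even #(u ∩ {0, 1, 4, 5}) → Even #(u ∩ {0, 2, 4, 6}) →
    ∃ a b c d : Bool, u = symmDiff (symmDiff (cond a {0, 1, 2, 3} ∅) (cond b {0, 1, 4, 5} ∅))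
      (symmDiff (cond c {0, 2, 4, 6} ∅) (cond d univ ∅)) := by
  decide

lemma symmDiff_image {α β : Type*} [DecidableEq α] [DecidableEq β] {f : α → β}
    (hf : Function.Injective f) (s t : Finset α) :
    (symmDiff s t).image f = symmDiff (s.image f) (t.image f) :=
  image_symmDiff _ _ hf

/-- The union of the two copies of a subset of one half of the coordinates. -/
def double {κ ι : Type*} [DecidableEq ι] (e : κ ⊕ κ ≃ ι) (u : Finset κ) : Finset ι :=
  u.image (e ∘ Sum.inl) ∪ u.image (e ∘ Sum.inr)

section double

variable {κ ι : Type*} (e : κ ⊕ κ ≃ ι)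

lemma injective_left : Function.Injective (e ∘ Sum.inl) := e.injective.comp Sum.inl_injective

lemma injective_right : Function.Injective (e ∘ Sum.inr) := e.injective.comp Sum.inr_injective

lemma double_eq_symmDiff [DecidableEq ι] (u : Finset κ) :
    double e u = symmDiff (u.image (e ∘ Sum.inl)) (u.image (e ∘ Sum.inr)) := by
  have hd : Disjoint (u.image (e ∘ Sum.inl)) (u.image (e ∘ Sum.inr)) := by
    rw [disjoint_left]
    intro a ha hb
    obtain ⟨b, -, rfl⟩ := mem_image.1 ha
    obtain ⟨c, -, hc⟩ := mem_image.1 hb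
    simp at hc
  rw [hd.symmDiff_eq_sup]
  rfl

lemma double_symmDiff [DecidableEq κ] [DecidableEq ι] (u v : Finset κ) :
    double e (symmDiff u v) = symmDiff (double e u) (double e v) := by
  simp only [double_eq_symmDiff, symmDiff_image (injective_left e),
    symmDiff_image (injective_right e)]
  rw [symmDiff_symmDiff_symmDiff_comm]

lemma double_empty [DecidableEq ι] : double e (∅ : Finset κ) = ∅ := by simp [double]

end double

namespace SelfDual

variable {ι : Type*} [Fintype ι] [DecidableEq ι] {C : Finset (Finset ι)} {k : ℕ}

lemma double_symmDiff_mem {κ : Type*} [DecidableEq κ] (h : SelfDual C k) (e : κ ⊕ κ ≃ ι)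
    {u v : Finset κ} (hu : double e u ∈ C) (hv : double e v ∈ C) :
    double e (symmDiff u v) ∈ C := by
  rw [double_symmDiff]
  exact h.symmDiff_mem hu hv

lemma double_cond_mem {κ : Type*} [DecidableEq κ] (h : SelfDual C k) (e : κ ⊕ κ ≃ ι)
    {u : Finset κ} (hu : double e u ∈ C) (a : Bool) : double e (cond a u ∅) ∈ C := by
  cases a
  · simpa [double_empty] using h.empty_mem
  · exact hu

/-- A code in which the coordinates fall into pairs any two of which form a word of weight four
is reflective. -/
lemma reflective_of_pairs (h : SelfDual C (2 * k)) (hk : k = 2 ∨ k = 3)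
    (p : (Fin k × Bool) ⊕ (Fin k × Bool) ≃ ι)
    (hp : ∀ a b : Fin k ⊕ Fin k, a ≠ b →
      univ.image (fun c => p (Sum.map (·, c) (·, c) a)) ∪
        univ.image (fun c => p (Sum.map (·, c) (·, c) b)) ∈ C)
    (ht : univ.image (fun a : Fin k ⊕ Fin k => p (Sum.map (·, true) (·, true) a)) ∈ C) :
    Reflective C := by
  refine ⟨Fin k × Bool, inferInstance, inferInstance, p, fun u hu => ?_⟩
  change double p u ∈ C
  have hb : ∀ f : Bool → ι, univ.image f = {f true, f false} := fun f => by
    rw [Fintype.univ_bool, image_insert, image_singleton]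
  simp only [hb] at hp
  have hw : ∀ a b : Fin k, a ≠ b → Even #(u ∩ {(a, true), (a, false), (b, true), (b, false)}) := by
    intro a b hab
    apply hu
    have := hp (Sum.inl a) (Sum.inl b) (by simpa using hab)
    simpa only [image_insert, image_singleton, insert_union, singleton_union, Function.comp,
      Sum.map_inl] using this
  have hpair : ∀ a : Fin k, double p {(a, true), (a, false)} ∈ C := by
    intro a
    have := hp (Sum.inl a) (Sum.inr a) (by simp)
    simpa only [double, image_insert, image_singleton, Function.comp, Sum.map_inl, Sum.map_inr]
      using this
  have htr : double p (univ.image fun m : Fin k => (m, true)) ∈ C := by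
    convert ht using 1
    ext v
    simp only [double, mem_image, mem_union, mem_univ, true_and, Function.comp]
    aesop
  rcases hk with rfl | rfl
  · obtain ⟨a, b, c, rfl⟩ := exists_generators_pairs_two u (hw 0 1 (by decide))
    exact h.double_symmDiff_mem p (h.double_symmDiff_mem p (h.double_cond_mem p (hpair 0) a)
      (h.double_cond_mem p (hpair 1) b)) (h.double_cond_mem p htr c)
  · obtain ⟨a, b, c, d, rfl⟩ := exists_generators_pairs_three u (hw 0 1 (by decide))
      (hw 0 2 (by decide))
    exact h.double_symmDiff_mem p (h.double_symmDiff_mem p (h.double_cond_mem p (hpair 0) a)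
      (h.double_cond_mem p (hpair 1) b)) (h.double_symmDiff_mem p
      (h.double_cond_mem p (hpair 2) c) (h.double_cond_mem p htr d))

/-- A code made of two mirror Fano configurations is reflective. -/
lemma reflective_of_fano (h : SelfDual C 7) (e : Fin 7 ⊕ Fin 7 ≃ ι)
    (hl : ∀ w ∈ ({{0, 1, 2, 3}, {0, 1, 4, 5}, {0, 2, 4, 6}} : Finset (Finset (Fin 7))),
      w.image (e ∘ Sum.inl) ∈ C ∧ w.image (e ∘ Sum.inr) ∈ C) : Reflective C := by
  refine ⟨Fin 7, inferInstance, inferInstance, e, fun u hu => ?_⟩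
  change double e u ∈ C
  have hd : ∀ w ∈ ({{0, 1, 2, 3}, {0, 1, 4, 5}, {0, 2, 4, 6}} : Finset (Finset (Fin 7))),
      double e w ∈ C := by
    intro w hw
    rw [double_eq_symmDiff]
    exact h.symmDiff_mem (hl w hw).1 (hl w hw).2
  have huniv : double e univ ∈ C := by
    convert h.univ_mem using 1
    ext v
    obtain ⟨a | a, rfl⟩ := e.surjective v <;> simp [double]
  obtain ⟨a, b, c, d, rfl⟩ := exists_generators_fano u (hu _ (hl _ (by simp)).1)
    (hu _ (hl _ (by simp)).1) (hu _ (hl _ (by simp)).1)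
  exact h.double_symmDiff_mem e (h.double_symmDiff_mem e
    (h.double_cond_mem e (hd _ (by simp)) a) (h.double_cond_mem e (hd _ (by simp)) b))
    (h.double_symmDiff_mem e (h.double_cond_mem e (hd _ (by simp)) c)
      (h.double_cond_mem e huniv d))

/-- Blocks through two common coordinates that exhaust all coordinates split them into pairs. -/
lemma reflective_of_sunflower (h : SelfDual C (2 * k)) (hk : k = 2 ∨ k = 3) {i j : ι}
    (hij : j ≠ i) (T : Finset (Finset ι)) (hT : T ⊆ blocks C i) (hj : ∀ B ∈ T, j ∈ B)
    (hcard : #T + 1 = 2 * k) : Reflective C := by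
  set c : Finset ι := {i, j} with hc
  have hc2 : #c = 2 := card_pair hij.symm
  have hcB : ∀ B ∈ T, c ⊆ B := fun B hB => by
    intro a ha
    rcases mem_insert.1 ha with rfl | ha
    · exact (mem_blocks.1 (hT hB)).2.1
    · rw [mem_singleton.1 ha]; exact hj B hB
  set P : Finset (Finset ι) := insert c (T.image (· \ c)) with hP
  have hinter : ∀ A ∈ T, ∀ B ∈ T, A ≠ B → A ∩ B = c := by
    intro A hA B hB hAB
    refine (eq_of_subset_of_card_le (subset_inter (hcB A hA) (hcB B hB)) ?_).symm
    rw [h.card_inter_blocks (hT hA) (hT hB) hAB, hc2]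
  have hcardB : ∀ B ∈ T, #(B \ c) = 2 := by
    intro B hB
    rw [card_sdiff_of_subset (hcB B hB), (mem_blocks.1 (hT hB)).2.2, hc2]
  have hP2 : ∀ q ∈ P, #q = 2 := by
    intro q hq
    rcases mem_insert.1 hq with rfl | hq
    · exact hc2
    · obtain ⟨B, hB, rfl⟩ := mem_image.1 hq
      exact hcardB B hB
  have hPd : ∀ q ∈ P, ∀ r ∈ P, q ≠ r → Disjoint q r := by
    have h1 : ∀ B ∈ T, Disjoint c (B \ c) := fun B _ => disjoint_sdiff
    intro q hq r hr hqr
    rcases mem_insert.1 hq with rfl | hq <;> rcases mem_insert.1 hr with rfl | hr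
    · exact absurd rfl hqr
    · obtain ⟨B, hB, rfl⟩ := mem_image.1 hr
      exact h1 B hB
    · obtain ⟨B, hB, rfl⟩ := mem_image.1 hq
      exact (h1 B hB).symm
    · obtain ⟨A, hA, rfl⟩ := mem_image.1 hq
      obtain ⟨B, hB, rfl⟩ := mem_image.1 hr
      have hAB : A ≠ B := by rintro rfl; exact hqr rfl
      rw [disjoint_left]
      intro a ha hb
      rw [mem_sdiff] at ha hb
      exact ha.2 (hinter A hA B hB hAB ▸ mem_inter.2 ⟨ha.1, hb.1⟩)
  have hPcard : #P = 2 * k := by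
    rw [hP, card_insert_of_notMem, card_image_of_injOn, hcard]
    · intro A hA B hB hAB
      rw [← sdiff_union_of_subset (hcB A hA), ← sdiff_union_of_subset (hcB B hB)]
      exact congrArg (· ∪ c) hAB
    · intro hmem
      obtain ⟨B, hB, hBc⟩ := mem_image.1 hmem
      have : i ∈ B \ c := by rw [hBc]; exact mem_insert_self _ _
      exact (mem_sdiff.1 this).2 (mem_insert_self _ _)
  have hPC : ∀ q ∈ P, ∀ r ∈ P, q ≠ r → symmDiff q r ∈ C := by
    have h1 : ∀ B ∈ T, symmDiff c (B \ c) ∈ C := fun B hB => by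
      rw [(disjoint_sdiff : Disjoint c (B \ c)).symmDiff_eq_sup]
      change c ∪ B \ c ∈ C
      rw [union_sdiff_of_subset (hcB B hB)]
      exact (mem_blocks.1 (hT hB)).1
    have h2 : ∀ q ∈ P, symmDiff c q ∈ C := by
      intro q hq
      rcases mem_insert.1 hq with rfl | hq
      · simpa using h.empty_mem
      · obtain ⟨B, hB, rfl⟩ := mem_image.1 hq
        exact h1 B hB
    intro q hq r hr _
    have := h.symmDiff_mem (h2 q hq) (h2 r hr)
    rwa [symmDiff_symmDiff_symmDiff_comm, symmDiff_self, bot_symmDiff] at this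
  -- The pair `c` is not a word, so by self-duality some word meets it oddly. Since sums of two
  -- pairs are words, `t` meets every pair oddly and is a transversal.
  obtain ⟨t, ht, htodd⟩ : ∃ t ∈ C, ¬ Even #(c ∩ t) := by
    by_contra! hall
    exact h.dist c ((h.mem_iff c).2 hall) hc2
  have htP : ∀ q ∈ P, #(q ∩ t) = 1 := by
    intro q hq
    have h0 : ¬ Even #(q ∩ t) := by
      by_cases hqc : c = q
      · rwa [← hqc]
      · have h1 := h.even_inter (hPC c (mem_insert_self _ _) q hq hqc) ht
        rw [even_card_symmDiff_inter] at h1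
        rwa [← h1]
    have h1 : #(q ∩ t) ≤ 2 := hP2 q hq ▸ card_le_card inter_subset_left
    rw [Nat.not_even_iff_odd] at h0
    obtain ⟨m, hm⟩ := h0
    omega
  have hex : ∀ q ∈ P, ∃ f : Bool → ι, q = univ.image f ∧ f true ∈ t ∧ f false ∉ t := by
    intro q hq
    obtain ⟨a, ha⟩ := card_eq_one.1 (htP q hq)
    have h1 : #(q \ t) = 1 := by
      have := card_sdiff_add_card_inter q t
      rw [htP q hq, hP2 q hq] at this
      omega
    obtain ⟨b, hb⟩ := card_eq_one.1 h1
    refine ⟨fun x => cond x a b, ?_, ?_, ?_⟩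
    · rw [← sdiff_union_inter q t, ha, hb]
      ext v
      simp [eq_comm, or_comm]
    · have : a ∈ q ∩ t := ha ▸ mem_singleton_self a
      exact (mem_inter.1 this).2
    · have : b ∈ q \ t := hb ▸ mem_singleton_self b
      exact (mem_sdiff.1 this).2
  have : Nonempty ι := ⟨i⟩
  choose! f hf1 hf2 hf3 using hex
  have eP : Fin k ⊕ Fin k ≃ P := Fintype.equivOfCardEq (by simp [hPcard]; ring)
  have hfmem : ∀ q ∈ P, ∀ x, f q x ∈ q := fun q hq x => by
    have hx : f q x ∈ univ.image (f q) := mem_image_of_mem _ (mem_univ x)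
    rwa [← hf1 q hq] at hx
  set g : (Fin k ⊕ Fin k) × Bool → ι := fun z => f (eP z.1) z.2 with hg
  have hginj : Function.Injective g := by
    rintro ⟨a, x⟩ ⟨b, y⟩ hab
    have hab' : f (eP a) x = f (eP b) y := hab
    have h1 : eP a = eP b := by
      by_contra hne
      have h2 := hPd _ (eP a).2 _ (eP b).2 (fun h' => hne (Subtype.ext h'))
      exact (disjoint_left.1 h2) (hfmem _ (eP a).2 x) (hab' ▸ hfmem _ (eP b).2 y)
    obtain rfl := eP.injective h1
    have h2 := hf2 _ (eP a).2
    have h3 := hf3 _ (eP a).2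
    rcases x <;> rcases y <;> first | rfl | (rw [hab'] at h3; exact absurd h2 h3) |
      (rw [hab'] at h2; exact absurd h2 h3)
  have hgbij : Function.Bijective g := by
    rw [Fintype.bijective_iff_injective_and_card]
    refine ⟨hginj, ?_⟩
    simp [h.card_index]
    ring
  set p : (Fin k × Bool) ⊕ (Fin k × Bool) ≃ ι :=
    (Equiv.sumProdDistrib _ _ _).symm.trans (Equiv.ofBijective g hgbij) with hpdef
  have hpg : ∀ a x, p (Sum.map (·, x) (·, x) a) = f (eP a) x := by
    rintro (a | a) x <;> rfl
  refine h.reflective_of_pairs hk p ?_ ?_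
  · intro a b hab
    simp only [hpg]
    have hne : (eP a : Finset ι) ≠ eP b := fun h' => hab (eP.injective (Subtype.ext h'))
    have h1 : ∀ a, univ.image (fun x => f (eP a) x) = (eP a : Finset ι) :=
      fun a => (hf1 _ (eP a).2).symm
    rw [h1, h1]
    have h2 := hPC _ (eP a).2 _ (eP b).2 hne
    rwa [(hPd _ (eP a).2 _ (eP b).2 hne).symmDiff_eq_sup] at h2
  · simp only [hpg]
    convert ht using 1
    ext v
    simp only [mem_image, mem_univ, true_and]
    constructor
    · rintro ⟨a, rfl⟩
      exact hf2 _ (eP a).2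
    · intro hv
      obtain ⟨⟨a, x⟩, rfl⟩ := hgbij.2 v
      cases x
      · exact absurd hv (hf3 _ (eP a).2)
      · exact ⟨a, rfl⟩

lemma reflective_four (h : SelfDual C 4) (i : ι) : Reflective C := by
  obtain ⟨j, hj, h3⟩ := h.exists_common_point (i := i) (by rw [h.card_blocks_four]; norm_num)
  obtain ⟨T, hT, hT3⟩ := exists_subset_card_eq h3
  -- Three blocks through `i` and `j` split the eight coordinates into four pairs.
  exact reflective_of_sunflower (k := 2) h (Or.inl rfl) hj T (fun B hB => (mem_filter.1 (hT hB)).1)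
    (fun B hB => (mem_filter.1 (hT hB)).2) (by rw [hT3])

lemma reflective_six (h : SelfDual C 6) (i : ι) : Reflective C := by
  obtain ⟨j, hj, h3⟩ := h.exists_common_point (i := i) (by rw [h.card_blocks_six])
  refine reflective_of_sunflower (k := 3) h (Or.inr rfl) hj (blocks C i) subset_rfl
    (fun B hB => ?_) (by rw [h.card_blocks_six])
  -- A block missing `j` would force six blocks through `j`, but there are five. So all five contain
  -- `j` and split the twelve coordinates into six pairs.
  by_contra hjB
  have h1 := h.two_mul_le_card_blocks hB hjB
  rw [h.card_blocks_six] at h1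
  omega

end SelfDual

/-! ### Length fourteen: two Fano configurations -/

/-- The complements of the lines of a Fano plane that avoid a given point. -/
def fanoBlock : Fin 4 → Finset (Fin 7) :=
  ![{0, 1, 2, 3}, {0, 1, 4, 5}, {0, 2, 4, 6}, {0, 3, 5, 6}]

lemma fanoBlock_separates : ∀ s t : Fin 7, (∀ d, s ∈ fanoBlock d ↔ t ∈ fanoBlock d) → s = t := by
  decide

lemma fanoBlock_covers : ∀ s : Fin 7, ∃ d, s ∈ fanoBlock d := by
  decide

namespace SelfDual

variable {ι : Type*} [Fintype ι] [DecidableEq ι] {C : Finset (Finset ι)} {k : ℕ}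

/-- The union of the blocks through a coordinate contains all blocks through its elements. -/
lemma subset_biUnion_blocks (h : SelfDual C k) {r : ℕ} (hr : ∀ i, #(blocks C i) = r) {i p : ι}
    (hp : p ∈ (blocks C i).biUnion id) {D : Finset ι} (hD : D ∈ blocks C p) :
    D ⊆ (blocks C i).biUnion id := by
  obtain ⟨A, hA, hpA⟩ := mem_biUnion.1 hp
  have hU : ∀ B ∈ blocks C i, B ⊆ (blocks C i).biUnion id := fun B hB => subset_biUnion_of_mem id hB
  set T := {B ∈ blocks C i | p ∈ B}
  set T' := {B ∈ blocks C i | p ∉ B}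
  have hd : Disjoint T (T'.image (symmDiff A)) := by
    rw [disjoint_left]
    intro B hB hB'
    obtain ⟨E, hE, rfl⟩ := mem_image.1 hB'
    have h1 := (mem_blocks.1 (mem_filter.1 hB).1).2.1
    have h2 := (mem_blocks.1 (mem_filter.1 hE).1).2.1
    have h3 := (mem_blocks.1 hA).2.1
    rw [mem_symmDiff] at h1
    tauto
  have hs : T ∪ T'.image (symmDiff A) ⊆ blocks C p := by
    intro B hB
    rcases mem_union.1 hB with hB | hB
    · exact mem_blocks_of_mem (mem_filter.1 hB).1 (mem_filter.1 hB).2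
    · obtain ⟨E, hE, rfl⟩ := mem_image.1 hB
      rw [symmDiff_comm]
      exact h.symmDiff_mem_blocks (mem_filter.1 hE).1 hA (mem_filter.1 hE).2 hpA
  -- The blocks through `i` that contain `p`, with the sums of `A` and those that miss `p`, already
  -- number `r`, so they are all the blocks through `p`.
  have heq := eq_of_subset_of_card_le hs (by
    rw [card_union_of_disjoint hd, card_image_of_injective _ (symmDiff_right_injective A), hr,
      card_filter_add_card_filter_not, hr])
  rw [← heq, mem_union, mem_image] at hD
  rcases hD with hD | ⟨E, hE, rfl⟩
  · exact hU D (mem_filter.1 hD).1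
  · intro a ha
    rw [mem_symmDiff] at ha
    rcases ha with ha | ha
    · exact hU A hA ha.1
    · exact hU E (mem_filter.1 hE).1 ha.1

lemma disjoint_biUnion_blocks (h : SelfDual C k) {r : ℕ} (hr : ∀ i, #(blocks C i) = r) {i q : ι}
    (hq : q ∉ (blocks C i).biUnion id) :
    Disjoint ((blocks C i).biUnion id) ((blocks C q).biUnion id) := by
  rw [disjoint_left]
  intro p hp hp'
  obtain ⟨B, hB, hpB⟩ := mem_biUnion.1 hp'
  exact hq (h.subset_biUnion_blocks hr hp (mem_blocks_of_mem hB hpB) (mem_blocks.1 hB).2.1)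

/-- Three common blocks would force all four blocks through `i` to contain `j`. Their union then has
`2 + 4 * 2 = 10` points, and the remaining four points have room for one block only, not four. -/
lemma card_common_le_two (h : SelfDual C 7) {i j : ι} (hij : j ≠ i) :
    #{B ∈ blocks C i | j ∈ B} ≤ 2 := by
  by_contra! hlt
  have hall : ∀ B ∈ blocks C i, j ∈ B := by
    intro B hB
    by_contra hjB
    have h1 := h.two_mul_le_card_blocks hB hjB
    rw [h.card_blocks_seven] at h1
    omega
  set U := (blocks C i).biUnion id with hU
  have hc2 : #({i, j} : Finset ι) = 2 := card_pair hij.symm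
  have hcB : ∀ B ∈ blocks C i, {i, j} ⊆ B := fun B hB => by
    intro a ha
    rcases mem_insert.1 ha with rfl | ha
    · exact (mem_blocks.1 hB).2.1
    · rw [mem_singleton.1 ha]; exact hall B hB
  have hpet : #((blocks C i).biUnion fun B => B \ {i, j}) = 8 := by
    rw [card_biUnion, sum_congr rfl (g := fun _ => 2), sum_const, h.card_blocks_seven]
    · norm_num
    · intro B hB
      rw [card_sdiff_of_subset (hcB B hB), (mem_blocks.1 hB).2.2, hc2]
    · intro A hA B hB hAB
      have h1 : {i, j} = A ∩ B := eq_of_subset_of_card_le (subset_inter (hcB A hA) (hcB B hB)) (by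
        rw [h.card_inter_blocks hA hB hAB, hc2])
      refine disjoint_left.2 fun a ha hb => ?_
      rw [mem_sdiff] at ha hb
      exact ha.2 (h1 ▸ mem_inter.2 ⟨ha.1, hb.1⟩)
  have hU10 : 10 ≤ #U := by
    have hsub : {i, j} ∪ ((blocks C i).biUnion fun B => B \ {i, j}) ⊆ U := by
      obtain ⟨A, hA⟩ : (blocks C i).Nonempty := card_pos.1 (by rw [h.card_blocks_seven]; norm_num)
      refine union_subset ((hcB A hA).trans (subset_biUnion_of_mem id hA)) ?_
      exact biUnion_mono fun B _ => sdiff_subset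
    have h1 := card_le_card hsub
    rw [card_union_of_disjoint, hpet, hc2] at h1
    · exact h1
    · rw [disjoint_biUnion_right]
      exact fun B _ => disjoint_sdiff
  have hUle : #U ≤ 10 := by
    have hsub : U ⊆ {i, j} ∪ ((blocks C i).biUnion fun B => B \ {i, j}) := by
      intro a ha
      obtain ⟨B, hB, haB⟩ := mem_biUnion.1 ha
      by_cases hac : a ∈ ({i, j} : Finset ι)
      · exact mem_union_left _ hac
      · exact mem_union_right _ (mem_biUnion.2 ⟨B, hB, mem_sdiff.2 ⟨haB, hac⟩⟩)
    have h1 := (card_le_card hsub).trans (card_union_le _ _)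
    rwa [hpet, hc2] at h1
  have hcard : #(univ : Finset ι) = 14 := by rw [card_univ, h.card_index]
  obtain ⟨q, hq⟩ : ∃ q, q ∉ U := by
    by_contra! hall
    have : U = univ := eq_univ_of_forall hall
    rw [this, hcard] at hUle
    omega
  have hdis := h.disjoint_biUnion_blocks h.card_blocks_seven hq
  have hle : blocks C q ⊆ {Uᶜ} := by
    intro B hB
    rw [mem_singleton]
    refine eq_of_subset_of_card_le ?_ ?_
    · intro a ha
      rw [mem_compl]
      exact fun haU => disjoint_left.1 hdis haU (mem_biUnion.2 ⟨B, hB, ha⟩)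
    · rw [card_compl, h.card_index, (mem_blocks.1 hB).2.2]
      omega
  have h1 := card_le_card hle
  rw [h.card_blocks_seven, card_singleton] at h1
  omega

/-- The blocks through a coordinate form the configuration of the complements of the lines of a
Fano plane. -/
lemma exists_fano (h : SelfDual C 7) (i : ι) : ∃ y : Fin 7 → ι, Function.Injective y ∧
    (∀ w ∈ ({{0, 1, 2, 3}, {0, 1, 4, 5}, {0, 2, 4, 6}} : Finset (Finset (Fin 7))),
      w.image y ∈ C) ∧ (blocks C i).biUnion id = univ.image y := by
  have b : Fin 4 ≃ blocks C i := Fintype.equivOfCardEq (by simp [h.card_blocks_seven])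
  have hb4 : ∀ a, #(b a : Finset ι) = 4 := fun a => (mem_blocks.1 (b a).2).2.2
  have hbi : ∀ a, i ∈ (b a : Finset ι) := fun a => (mem_blocks.1 (b a).2).2.1
  -- Any two of the four blocks share one point besides `i`, lying in no third block. The six pairs
  -- give six points, which with `i` form the seven points.
  have key : ∀ a c : Fin 4, a ≠ c → ∃ p ∈ (b a : Finset ι), p ∈ (b c : Finset ι) ∧
      ∀ d, d ≠ a → d ≠ c → p ∉ (b d : Finset ι) := by
    intro a c hac
    have hne : ∀ {x y : Fin 4}, x ≠ y → (b x : Finset ι) ≠ b y :=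
      fun hxy h' => hxy (b.injective (Subtype.ext h'))
    have h1 := h.card_inter_blocks (b a).2 (b c).2 (hne hac)
    have h2 : 1 < #((b a : Finset ι) ∩ b c) := by omega
    obtain ⟨p, hp, hpi⟩ := exists_mem_ne h2 i
    rw [mem_inter] at hp
    refine ⟨p, hp.1, hp.2, fun d hda hdc hpd => ?_⟩
    have h3 := h.card_common_le_two hpi
    have h4 : ({(b a : Finset ι), (b c : Finset ι), (b d : Finset ι)} : Finset (Finset ι)) ⊆
        {B ∈ blocks C i | p ∈ B} := by
      intro B hB
      rw [mem_filter]
      simp only [mem_insert, mem_singleton] at hB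
      rcases hB with rfl | rfl | rfl
      exacts [⟨(b a).2, hp.1⟩, ⟨(b c).2, hp.2⟩, ⟨(b d).2, hpd⟩]
    have h5 := card_le_card h4
    rw [card_eq_three.2 ⟨_, _, _, hne hac, hne hda.symm, hne hdc.symm, rfl⟩] at h5
    omega
  obtain ⟨p1, p1a, p1b, p1n⟩ := key 0 1 (by decide)
  obtain ⟨p2, p2a, p2b, p2n⟩ := key 0 2 (by decide)
  obtain ⟨p3, p3a, p3b, p3n⟩ := key 0 3 (by decide)
  obtain ⟨p4, p4a, p4b, p4n⟩ := key 1 2 (by decide)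
  obtain ⟨p5, p5a, p5b, p5n⟩ := key 1 3 (by decide)
  obtain ⟨p6, p6a, p6b, p6n⟩ := key 2 3 (by decide)
  set y : Fin 7 → ι := ![i, p1, p2, p3, p4, p5, p6] with hy
  have hmem : ∀ s d, y s ∈ (b d : Finset ι) ↔
      s ∈ fanoBlock d := by
    intro s d
    fin_cases s
    · simpa [hy, hbi] using by fin_cases d <;> decide
    · fin_cases d
      · exact iff_of_true p1a (by decide)
      · exact iff_of_true p1b (by decide)
      · exact iff_of_false (p1n _ (by decide) (by decide)) (by decide)
      · exact iff_of_false (p1n _ (by decide) (by decide)) (by decide)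
    · fin_cases d
      · exact iff_of_true p2a (by decide)
      · exact iff_of_false (p2n _ (by decide) (by decide)) (by decide)
      · exact iff_of_true p2b (by decide)
      · exact iff_of_false (p2n _ (by decide) (by decide)) (by decide)
    · fin_cases d
      · exact iff_of_true p3a (by decide)
      · exact iff_of_false (p3n _ (by decide) (by decide)) (by decide)
      · exact iff_of_false (p3n _ (by decide) (by decide)) (by decide)
      · exact iff_of_true p3b (by decide)
    · fin_cases d
      · exact iff_of_false (p4n _ (by decide) (by decide)) (by decide)
      · exact iff_of_true p4a (by decide)
      · exact iff_of_true p4b (by decide)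
      · exact iff_of_false (p4n _ (by decide) (by decide)) (by decide)
    · fin_cases d
      · exact iff_of_false (p5n _ (by decide) (by decide)) (by decide)
      · exact iff_of_true p5a (by decide)
      · exact iff_of_false (p5n _ (by decide) (by decide)) (by decide)
      · exact iff_of_true p5b (by decide)
    · fin_cases d
      · exact iff_of_false (p6n _ (by decide) (by decide)) (by decide)
      · exact iff_of_false (p6n _ (by decide) (by decide)) (by decide)
      · exact iff_of_true p6a (by decide)
      · exact iff_of_true p6b (by decide)
  have hinj : Function.Injective y := by
    intro s t hst
    have h1 : ∀ d, (s ∈ fanoBlock d) ↔ t ∈ fanoBlock d := fun d => by rw [← hmem, ← hmem, hst]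
    exact fanoBlock_separates s t h1
  have hbimg : ∀ d, (b d : Finset ι) = (fanoBlock d).image y := by
    intro d
    refine (eq_of_subset_of_card_le ?_ ?_).symm
    · intro v hv
      obtain ⟨s, hs, rfl⟩ := mem_image.1 hv
      exact (hmem s d).2 hs
    · rw [hb4, card_image_of_injective _ hinj]
      revert d
      decide
  refine ⟨y, hinj, ?_, ?_⟩
  · intro w hw
    simp only [mem_insert, mem_singleton] at hw
    have hbC : ∀ d, (b d : Finset ι) ∈ C := fun d => (mem_blocks.1 (b d).2).1
    rcases hw with rfl | rfl | rfl
    · have := hbC 0; rw [hbimg] at this; exact this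
    · have := hbC 1; rw [hbimg] at this; exact this
    · have := hbC 2; rw [hbimg] at this; exact this
  · refine subset_antisymm ?_ ?_
    · intro v hv
      obtain ⟨B, hB, hvB⟩ := mem_biUnion.1 hv
      obtain ⟨d, hd⟩ := b.surjective ⟨B, hB⟩
      have : v ∈ (b d : Finset ι) := by rw [hd]; exact hvB
      rw [hbimg] at this
      exact image_subset_image (subset_univ _) this
    · intro v hv
      obtain ⟨s, -, rfl⟩ := mem_image.1 hv
      obtain ⟨d, hd⟩ : ∃ d, s ∈ fanoBlock d := fanoBlock_covers s
      exact mem_biUnion.2 ⟨b d, (b d).2, (hmem s d).2 hd⟩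

/-- The blocks through `i` cover seven points; those through a point outside cover the other seven,
and both carry the same configuration. -/
lemma reflective_seven (h : SelfDual C 7) (i : ι) : Reflective C := by
  obtain ⟨y, hy, hyC, hyU⟩ := h.exists_fano i
  obtain ⟨q, hq⟩ : ∃ q, q ∉ (blocks C i).biUnion id := by
    by_contra! hall
    have h1 : univ.image y = univ := by rw [← hyU]; exact eq_univ_of_forall hall
    have h2 := congrArg card h1
    rw [card_image_of_injective _ hy, card_univ, card_univ, h.card_index] at h2
    simp at h2
  obtain ⟨z, hz, hzC, hzU⟩ := h.exists_fano q
  have hdis := h.disjoint_biUnion_blocks h.card_blocks_seven hq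
  rw [hyU, hzU] at hdis
  have hinj : Function.Injective (Sum.elim y z) := by
    refine hy.sumElim hz fun a b hab => ?_
    exact disjoint_left.1 hdis (mem_image_of_mem y (mem_univ a))
      (hab ▸ mem_image_of_mem z (mem_univ b))
  have hbij : Function.Bijective (Sum.elim y z) := by
    rw [Fintype.bijective_iff_injective_and_card]
    exact ⟨hinj, by simp [h.card_index]⟩
  exact h.reflective_of_fano (Equiv.ofBijective _ hbij) fun w hw => ⟨hyC w hw, hzC w hw⟩

/-- Self-dual codes of length at most fourteen without words of weight two are reflective. -/
theorem reflective (h : SelfDual C k) (hk : k ≤ 7) (i : ι) : Reflective C := by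
  have h4 := h.four_le_length i
  interval_cases k
  · exact h.reflective_four i
  · exact (h.not_five i).elim
  · exact h.reflective_six i
  · exact h.reflective_seven i

end SelfDual

/-! ### Relations of a tuple and reflection positivity -/

/-- The space of binary `m`-tuples. -/
abbrev Vec (m : ℕ) : Type := Fin m → ZMod 2

section Char2

variable {m : ℕ}

lemma Vec.add_self (v : Vec m) : v + v = 0 :=
  funext fun i => CharTwo.add_self_eq_zero (v i)

lemma Vec.eq_of_add_eq_zero {v w : Vec m} (h : v + w = 0) : v = w := by
  rw [← add_left_inj w, h, Vec.add_self]

lemma sum_symmDiff_vec {ι : Type*} [DecidableEq ι] (x : ι → Vec m) (s t : Finset ι) :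
    ∑ i ∈ symmDiff s t, x i = ∑ i ∈ s, x i + ∑ i ∈ t, x i := by
  have h1 : ∑ i ∈ s, x i = ∑ i ∈ s \ t, x i + ∑ i ∈ s ∩ t, x i := by
    rw [← sum_sdiff (s₁ := s ∩ t) inter_subset_left, sdiff_inter_self_left]
  have h2 : ∑ i ∈ t, x i = ∑ i ∈ t \ s, x i + ∑ i ∈ s ∩ t, x i := by
    rw [← sum_sdiff (s₁ := s ∩ t) inter_subset_right, sdiff_inter_self_right]
  have h3 : ∑ i ∈ symmDiff s t, x i = ∑ i ∈ s \ t, x i + ∑ i ∈ t \ s, x i := by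
    rw [symmDiff, sup_eq_union, sum_union disjoint_sdiff_sdiff]
  have h4 := Vec.add_self (∑ i ∈ s ∩ t, x i)
  rw [h1, h2, h3, add_add_add_comm, h4, add_zero]

end Char2

/-- The sets of even size over which the entries of `x` sum to zero. -/
def rel {ι : Type*} [Fintype ι] [DecidableEq ι] {m : ℕ} (x : ι → Vec m) : Finset (Finset ι) :=
  {s | Even #s ∧ ∑ i ∈ s, x i = 0}

lemma mem_rel {ι : Type*} [Fintype ι] [DecidableEq ι] {m : ℕ} {x : ι → Vec m} {s : Finset ι} :
    s ∈ rel x ↔ Even #s ∧ ∑ i ∈ s, x i = 0 := by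
  simp [rel]

/-- Grouping by the common value of `g` produces a sum of squares. -/
lemma sum_fiber_mul_nonneg {α β : Type*} [Fintype α] [Fintype β] [DecidableEq β] (g : α → β)
    (F : α → ℝ) : 0 ≤ ∑ y, ∑ z, if g y = g z then F y * F z else 0 := by
  have h : ∑ y, ∑ z, (if g y = g z then F y * F z else 0)
      = ∑ l, (∑ y with g y = l, F y) ^ 2 := by
    rw [← sum_fiberwise (s := univ) (g := g)]
    refine sum_congr rfl fun l _ => ?_
    rw [pow_two, sum_mul_sum]
    refine sum_congr rfl fun y hy => ?_
    rw [sum_filter]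
    refine sum_congr rfl fun z _ => ?_
    rw [(mem_filter.1 hy).2]
    simp only [eq_comm]
  rw [h]
  exact sum_nonneg fun l _ => sq_nonneg _

section Reflection

variable {ι : Type*} [Fintype ι] [DecidableEq ι] {C : Finset (Finset ι)} {k m : ℕ}

/-- The code is generated by the left words `w`, their right copies, and the doubles of the `u` dual
to them. Its relations therefore constrain each half separately by the same conditions and couple
the halves only through an equality of the `u`-sums, which is the shape needed for a sum of squares.
-/
lemma SelfDual.subset_rel_iff (h : SelfDual C k) {κ : Type*} [DecidableEq κ] [Fintype κ]
    (e : κ ⊕ κ ≃ ι) (hC : ∀ u : Finset κ,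
      (∀ w : Finset κ, w.image (e ∘ Sum.inl) ∈ C → Even #(u ∩ w)) → double e u ∈ C)
    (x : ι → Vec m) :
    C ⊆ rel x ↔ (∀ w : Finset κ, w.image (e ∘ Sum.inl) ∈ C → ∑ i ∈ w, x (e (Sum.inl i)) = 0) ∧
      (∀ w : Finset κ, w.image (e ∘ Sum.inl) ∈ C → ∑ i ∈ w, x (e (Sum.inr i)) = 0) ∧
      ∀ u : Finset κ, (∀ w : Finset κ, w.image (e ∘ Sum.inl) ∈ C → Even #(u ∩ w)) →
        ∑ i ∈ u, x (e (Sum.inl i)) = ∑ i ∈ u, x (e (Sum.inr i)) := by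
  have hl := injective_left e
  have hr := injective_right e
  have sl : ∀ w : Finset κ, ∑ i ∈ w.image (e ∘ Sum.inl), x i = ∑ i ∈ w, x (e (Sum.inl i)) :=
    fun w => sum_image fun a _ b _ hab => hl hab
  have sr : ∀ w : Finset κ, ∑ i ∈ w.image (e ∘ Sum.inr), x i = ∑ i ∈ w, x (e (Sum.inr i)) :=
    fun w => sum_image fun a _ b _ hab => hr hab
  have horth : ∀ v w : Finset κ, v.image (e ∘ Sum.inl) ∈ C → w.image (e ∘ Sum.inl) ∈ C →
      Even #(v ∩ w) := by
    intro v w hv hw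
    have := h.even_inter hv hw
    rwa [← image_inter _ _ hl, card_image_of_injective _ hl] at this
  have hlr : ∀ w : Finset κ, w.image (e ∘ Sum.inl) ∈ C → w.image (e ∘ Sum.inr) ∈ C := by
    intro w hw
    have h1 := hC w fun v hv => horth w v hw hv
    rw [double_eq_symmDiff, symmDiff_comm] at h1
    exact (h.symmDiff_mem_iff hw).1 h1
  constructor
  · intro hx
    refine ⟨fun w hw => ?_, fun w hw => ?_, fun u hu => ?_⟩
    · rw [← sl]
      exact (mem_rel.1 (hx hw)).2
    · rw [← sr]
      exact (mem_rel.1 (hx (hlr w hw))).2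
    · have h1 := (mem_rel.1 (hx (hC u hu))).2
      rw [double_eq_symmDiff, sum_symmDiff_vec, sl, sr] at h1
      exact Vec.eq_of_add_eq_zero h1
  · rintro ⟨h1, h2, h3⟩ s hs
    refine mem_rel.2 ⟨h.even_card hs, ?_⟩
    set a : Finset κ := {i | e (Sum.inl i) ∈ s} with ha
    set b : Finset κ := {i | e (Sum.inr i) ∈ s} with hb
    have hsab : s = symmDiff (a.image (e ∘ Sum.inl)) (b.image (e ∘ Sum.inr)) := by
      ext v
      obtain ⟨j | j, rfl⟩ := e.surjective v <;> simp [mem_symmDiff, ha, hb]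
    have haw : ∀ w : Finset κ, w.image (e ∘ Sum.inl) ∈ C → Even #(a ∩ w) := by
      intro w hw
      have h4 := h.even_inter hs hw
      have h5 : s ∩ w.image (e ∘ Sum.inl) = (a ∩ w).image (e ∘ Sum.inl) := by
        ext v
        obtain ⟨j | j, rfl⟩ := e.surjective v <;> simp [ha]
      rwa [h5, card_image_of_injective _ hl] at h4
    have hbw : ∀ w : Finset κ, w.image (e ∘ Sum.inl) ∈ C → Even #(b ∩ w) := by
      intro w hw
      have h4 := h.even_inter hs (hlr w hw)
      have h5 : s ∩ w.image (e ∘ Sum.inr) = (b ∩ w).image (e ∘ Sum.inr) := by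
        ext v
        obtain ⟨j | j, rfl⟩ := e.surjective v <;> simp [hb]
      rwa [h5, card_image_of_injective _ hr] at h4
    have hv : ∀ w : Finset κ, w.image (e ∘ Sum.inl) ∈ C → Even #(symmDiff a b ∩ w) := by
      intro w hw
      rw [even_card_symmDiff_inter]
      simp [haw w hw, hbw w hw]
    have hda := hC a haw
    -- Adding the double of `a` clears the left half of `s`.
    have h6 : (symmDiff a b).image (e ∘ Sum.inr) ∈ C := by
      have := h.symmDiff_mem hda hs
      rw [double_eq_symmDiff, hsab, symmDiff_symmDiff_symmDiff_comm, symmDiff_self,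
        bot_symmDiff] at this
      rwa [symmDiff_image hr]
    have h7 : (symmDiff a b).image (e ∘ Sum.inl) ∈ C := by
      have := hC _ hv
      rw [double_eq_symmDiff] at this
      exact (h.symmDiff_mem_iff h6).1 this
    have h8 := h2 _ h7
    rw [sum_symmDiff_vec] at h8
    rw [hsab, sum_symmDiff_vec, sl, sr, h3 a haw, h8]

/-- Reflection positivity: summing a product of signs over all tuples with the relations of a
reflective code gives a nonnegative number. -/
lemma SelfDual.sum_prod_nonneg (h : SelfDual C k) (hC : Reflective C) (f : Vec m → ℝ) :
    0 ≤ ∑ x : ι → Vec m with C ⊆ rel x, ∏ i, f (x i) := by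
  classical
  obtain ⟨κ, _, _, e, he⟩ := hC
  have hiff := fun x : ι → Vec m => h.subset_rel_iff e he x
  set P : (κ → Vec m) → Prop := fun y =>
    ∀ w : Finset κ, w.image (e ∘ Sum.inl) ∈ C → ∑ i ∈ w, y i = 0 with hP
  set g : (κ → Vec m) → Finset κ → Vec m := fun y u =>
    if ∀ w : Finset κ, w.image (e ∘ Sum.inl) ∈ C → Even #(u ∩ w) then ∑ i ∈ u, y i else 0 with hg
  have key := sum_fiber_mul_nonneg g fun y => if P y then ∏ i, f (y i) else 0
  rw [← Fintype.sum_prod_type'] at key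
  convert key using 1
  rw [sum_filter]
  refine Fintype.sum_equiv ((Equiv.arrowCongr e.symm (Equiv.refl _)).trans
    (Equiv.sumArrowEquivProdArrow _ _ _)) _ _ fun x => ?_
  have hprod : ∏ i, f (x i) = (∏ i, f (x (e (Sum.inl i)))) * ∏ i, f (x (e (Sum.inr i))) := by
    rw [← e.prod_comp, Fintype.prod_sum_type]
  have hgiff : g (fun i => x (e (Sum.inl i))) = g (fun i => x (e (Sum.inr i))) ↔
      ∀ u : Finset κ, (∀ w : Finset κ, w.image (e ∘ Sum.inl) ∈ C → Even #(u ∩ w)) →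
        ∑ i ∈ u, x (e (Sum.inl i)) = ∑ i ∈ u, x (e (Sum.inr i)) := by
    rw [funext_iff]
    refine forall_congr' fun u => ?_
    simp only [hg]
    split_ifs with hu
    · exact ⟨fun h' _ => h', fun h' => h' hu⟩
    · simp [hu]
  change (if C ⊆ rel x then ∏ i, f (x i) else 0)
    = if g (fun i => x (e (Sum.inl i))) = g (fun i => x (e (Sum.inr i))) then
        (if P (fun i => x (e (Sum.inl i))) then ∏ i, f (x (e (Sum.inl i))) else 0)
          * (if P (fun i => x (e (Sum.inr i))) then ∏ i, f (x (e (Sum.inr i))) else 0) else 0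
  rw [hprod]
  simp only [hiff, hgiff, hP]
  split_ifs <;> first | rfl | tauto | simp

end Reflection

/-! ### Linear algebra of relation codes -/

/-- The indicator function of a set of coordinates. -/
def ind {ι : Type*} [DecidableEq ι] (s : Finset ι) (i : ι) : ZMod 2 := if i ∈ s then 1 else 0

/-- The set of coordinates at which a binary word does not vanish. -/
def supp {ι : Type*} [Fintype ι] (u : ι → ZMod 2) : Finset ι := {i | u i = 1}

section LinearAlgebra

variable {ι : Type*} [Fintype ι] [DecidableEq ι] {m : ℕ}

lemma zmod_two_cases (a : ZMod 2) : a = 0 ∨ a = 1 := by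
  revert a; decide

lemma ind_supp (u : ι → ZMod 2) : ind (supp u) = u := by
  funext i
  rcases zmod_two_cases (u i) with h | h <;> simp [ind, supp, h]

lemma supp_ind (s : Finset ι) : supp (ind s) = s := by
  ext i
  simp [ind, supp]

lemma ind_dotProduct (s : Finset ι) (u : ι → ZMod 2) : ind s ⬝ᵥ u = ∑ i ∈ s, u i := by
  simp [dotProduct, ind, sum_ite_mem]

lemma ind_dotProduct_ind (s t : Finset ι) : ind s ⬝ᵥ ind t = (#(s ∩ t) : ZMod 2) := by
  rw [ind_dotProduct]
  simp [ind, sum_ite_mem]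

/-- The rows of the matrix with columns `(1, x i)`. -/
def rows (x : ι → Vec m) : Option (Fin m) → ι → ZMod 2
  | none => 1
  | some l => fun i => x i l

lemma mem_rel_iff_dotProduct {x : ι → Vec m} {s : Finset ι} :
    s ∈ rel x ↔ ∀ l, ind s ⬝ᵥ rows x l = 0 := by
  rw [mem_rel, Option.forall]
  refine and_congr ?_ ?_
  · rw [ind_dotProduct, ← ZMod.natCast_eq_zero_iff_even]
    simp [rows]
  · rw [funext_iff]
    refine forall_congr' fun l => ?_
    rw [ind_dotProduct]
    simp [rows]

/-- The standard symmetric bilinear form on binary words. -/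
def dotForm (ι : Type*) [Fintype ι] [DecidableEq ι] : LinearMap.BilinForm (ZMod 2) (ι → ZMod 2) :=
  Matrix.toBilin' 1

lemma dotForm_apply (u v : ι → ZMod 2) : dotForm ι u v = u ⬝ᵥ v := by
  rw [dotForm, Matrix.toBilin'_apply', Matrix.one_mulVec]

lemma dotForm_nondegenerate : (dotForm ι).Nondegenerate :=
  LinearMap.BilinForm.nondegenerate_toBilin'_iff_det_ne_zero.2 (by simp)

/-- The words of the sets in `rel x`. -/
def relSubmodule (x : ι → Vec m) : Submodule (ZMod 2) (ι → ZMod 2) :=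
  (dotForm ι).orthogonal (Submodule.span (ZMod 2) (Set.range (rows x)))

lemma mem_relSubmodule {x : ι → Vec m} {u : ι → ZMod 2} :
    u ∈ relSubmodule x ↔ ∀ l, u ⬝ᵥ rows x l = 0 := by
  rw [relSubmodule, LinearMap.BilinForm.mem_orthogonal_iff]
  constructor
  · intro h l
    have h1 : dotForm ι (rows x l) u = 0 := h _ (Submodule.subset_span ⟨l, rfl⟩)
    rwa [dotForm_apply, dotProduct_comm] at h1
  · intro h n hn
    change dotForm ι n u = 0
    rw [dotForm_apply]
    induction hn using Submodule.span_induction with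
    | mem v hv => obtain ⟨l, rfl⟩ := hv; rw [dotProduct_comm]; exact h l
    | zero => simp
    | add v w _ _ hv hw => rw [add_dotProduct, hv, hw, add_zero]
    | smul a v _ hv => rw [smul_dotProduct, hv, smul_zero]

lemma ind_mem_relSubmodule {x : ι → Vec m} {s : Finset ι} : ind s ∈ relSubmodule x ↔ s ∈ rel x := by
  rw [mem_relSubmodule, mem_rel_iff_dotProduct]

lemma card_submodule_le {D : Finset (Finset ι)} {K : Submodule (ZMod 2) (ι → ZMod 2)}
    (h : ∀ s ∈ D, ind s ∈ K) : #D ≤ 2 ^ Module.finrank (ZMod 2) K := by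
  classical
  have h1 : #D ≤ Fintype.card K := by
    rw [← Fintype.card_coe]
    refine Fintype.card_le_of_injective (fun s : D => (⟨ind s.1, h s.1 s.2⟩ : K)) ?_
    intro s t hst
    have := congrArg (fun z : K => supp (z : ι → ZMod 2)) hst
    simp only [supp_ind] at this
    exact Subtype.ext this
  rwa [Module.card_eq_pow_finrank (K := ZMod 2), ZMod.card] at h1

lemma card_rel (x : ι → Vec m) : #(rel x) = 2 ^ Module.finrank (ZMod 2) (relSubmodule x) := by
  classical
  have h1 : #(rel x) = Fintype.card (relSubmodule x) := by
    rw [← Fintype.card_coe]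
    refine Fintype.card_congr
      { toFun := fun s => ⟨ind s.1, ind_mem_relSubmodule.2 s.2⟩
        invFun := fun u => ⟨supp u.1, by rw [← ind_mem_relSubmodule, ind_supp]; exact u.2⟩
        left_inv := fun s => Subtype.ext (supp_ind _)
        right_inv := fun u => Subtype.ext (ind_supp _) }
  rw [h1, Module.card_eq_pow_finrank (K := ZMod 2), ZMod.card]

/-- A code with more than `2 ^ k` words of length `2 k` has few tuples obeying its relations. -/
lemma card_filter_subset_rel_le {k : ℕ} (hι : Fintype.card ι = 2 * (k + 1))
    {D : Finset (Finset ι)} (hD : 2 ^ (k + 2) ≤ #D) :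
    #{x : ι → Vec m | D ⊆ rel x} ≤ (2 ^ m) ^ k := by
  classical
  set K := Submodule.span (ZMod 2) ((fun s => ind s) '' (D : Set (Finset ι))) with hK
  have hrank : k + 2 ≤ Module.finrank (ZMod 2) K := by
    have h1 := card_submodule_le (D := D) (K := K)
      fun s hs => Submodule.subset_span ⟨s, hs, rfl⟩
    exact (Nat.pow_le_pow_iff_right (by norm_num)).1 (hD.trans h1)
  have hq : Module.finrank (ZMod 2) ((ι → ZMod 2) ⧸ K) ≤ k := by
    have h1 := Submodule.finrank_quotient_add_finrank K
    rw [Module.finrank_pi, hι] at h1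
    omega
  -- The tuple `x` is a linear map on words that kills the span of `D`, hence a map on a quotient of
  -- dimension at most `k`.
  have hker : ∀ x : {x : ι → Vec m // D ⊆ rel x},
      K ≤ LinearMap.ker (Fintype.linearCombination (ZMod 2) x.1) := by
    intro x
    rw [hK, Submodule.span_le]
    rintro _ ⟨s, hs, rfl⟩
    have h1 := (mem_rel.1 (x.2 hs)).2
    simp only [SetLike.mem_coe, LinearMap.mem_ker, Fintype.linearCombination_apply, ind, ite_smul,
      one_smul, zero_smul, sum_ite_mem, univ_inter]
    exact h1
  have hle : Fintype.card {x : ι → Vec m // D ⊆ rel x}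
      ≤ Nat.card (((ι → ZMod 2) ⧸ K) →ₗ[ZMod 2] Vec m) := by
    rw [← Nat.card_eq_fintype_card]
    have : Finite (((ι → ZMod 2) ⧸ K) →ₗ[ZMod 2] Vec m) := Module.finite_of_finite (ZMod 2)
    refine Nat.card_le_card_of_injective
      (fun x : {x : ι → Vec m // D ⊆ rel x} => K.liftQ _ (hker x)) ?_
    intro x y hxy
    refine Subtype.ext (funext fun i => ?_)
    have h1 := LinearMap.congr_fun hxy (K.mkQ (Pi.single i 1))
    simpa using h1
  rw [← Fintype.card_subtype]
  refine hle.trans ?_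
  rw [Module.natCard_eq_pow_finrank (K := ZMod 2), Nat.card_zmod, Module.finrank_linearMap,
    Module.finrank_pi, Fintype.card_fin, ← pow_mul]
  refine Nat.pow_le_pow_right (by norm_num) ?_
  rw [mul_comm]
  exact Nat.mul_le_mul_left m hq

/-- A tuple is null if all quadratic forms sum to zero over it. -/
def IsNull (x : ι → Vec m) : Prop := ∀ l l' : Fin m, ∑ i, x i l * x i l' = 0

/-- `rel x` is the orthogonal of the row space `W`, and nullity makes `W` self-orthogonal. So `rel
x` has dimension at least `k`, with equality exactly when it is `W`; injectivity excludes weight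
two. -/
lemma selfDual_or_card_le {k : ℕ} (hι : Fintype.card ι = 2 * k) {x : ι → Vec m}
    (hx : IsNull x) (hinj : Function.Injective x) : SelfDual (rel x) k ∨ 2 ^ (k + 1) ≤ #(rel x) := by
  set W := Submodule.span (ZMod 2) (Set.range (rows x)) with hW
  have hWK : W ≤ relSubmodule x := by
    rw [hW, Submodule.span_le]
    rintro _ ⟨l, rfl⟩
    rw [SetLike.mem_coe, mem_relSubmodule]
    -- Bits equal their squares, so the diagonal conditions give the linear ones.
    have h1 : ∀ l, ∑ i, x i l = 0 := fun l => by
      rw [← hx l l]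
      refine sum_congr rfl fun i _ => ?_
      rcases zmod_two_cases (x i l) with h | h <;> simp [h]
    have h2 : ((2 * k : ℕ) : ZMod 2) = 0 := by
      rw [ZMod.natCast_eq_zero_iff_even]; exact even_two_mul k
    intro l'
    rcases l with _ | l <;> rcases l' with _ | l'
    · simp only [rows, one_dotProduct, Pi.one_apply, sum_const, card_univ, hι, nsmul_eq_mul, mul_one]
      exact h2
    · simp [rows, one_dotProduct, h1]
    · simp [rows, dotProduct_one, h1]
    · exact hx l l'
  have hdim : Module.finrank (ZMod 2) (relSubmodule x) = 2 * k - Module.finrank (ZMod 2) W := by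
    rw [relSubmodule, LinearMap.BilinForm.finrank_orthogonal dotForm_nondegenerate,
      Module.finrank_pi, hι]
  have hWle : Module.finrank (ZMod 2) W ≤ 2 * k := by
    have := Submodule.finrank_le W
    rwa [Module.finrank_pi, hι] at this
  have hmono := Submodule.finrank_mono hWK
  by_cases hk : k + 1 ≤ Module.finrank (ZMod 2) (relSubmodule x)
  · right
    rw [card_rel]
    exact Nat.pow_le_pow_right (by norm_num) hk
  left
  have hfin : Module.finrank (ZMod 2) (relSubmodule x) = k := by omega
  have heq : W = relSubmodule x := Submodule.eq_of_le_of_finrank_eq hWK (by omega)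
  refine ⟨fun s => ?_, hι, by rw [card_rel, hfin], fun s hs h2 => ?_⟩
  · rw [← ind_mem_relSubmodule, relSubmodule, ← hW, LinearMap.BilinForm.mem_orthogonal_iff]
    constructor
    · intro h t ht
      have h1 : dotForm ι (ind t) (ind s) = 0 := h _ (heq ▸ ind_mem_relSubmodule.2 ht)
      rw [dotForm_apply, ind_dotProduct_ind, ZMod.natCast_eq_zero_iff_even] at h1
      rwa [inter_comm]
    · intro h n hn
      change dotForm ι n (ind s) = 0
      rw [heq, ← ind_supp n, ind_mem_relSubmodule] at hn
      have h1 := h _ hn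
      rw [inter_comm, ← ZMod.natCast_eq_zero_iff_even, ← ind_dotProduct_ind, ind_supp] at h1
      rwa [dotForm_apply]
  · obtain ⟨i, j, hij, rfl⟩ := card_eq_two.1 h2
    have h1 := (mem_rel.1 hs).2
    rw [sum_pair hij] at h1
    exact hij (hinj (Vec.eq_of_add_eq_zero h1))

lemma SelfDual.injective {k : ℕ} {x : ι → Vec m} (h : SelfDual (rel x) k) :
    Function.Injective x := by
  intro i j hij
  by_contra hne
  refine h.dist {i, j} (mem_rel.2 ⟨by rw [card_pair hne]; exact even_two, ?_⟩) (card_pair hne)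
  rw [sum_pair hne, hij, Vec.add_self]

/-- The rows are orthogonal to every relation, so self-duality puts them among the relations, which
meet pairwise evenly. -/
lemma SelfDual.isNull {k : ℕ} {x : ι → Vec m} (h : SelfDual (rel x) k) : IsNull x := by
  have h1 : ∀ l, supp (fun i => x i l) ∈ rel x := by
    intro l
    rw [h.mem_iff]
    intro t ht
    have h2 := mem_rel_iff_dotProduct.1 ht (some l)
    have h3 : rows x (some l) = ind (supp fun i => x i l) := (ind_supp _).symm
    rw [h3, ind_dotProduct_ind, ZMod.natCast_eq_zero_iff_even] at h2
    rwa [inter_comm]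
  intro l l'
  have h2 := h.even_inter (h1 l) (h1 l')
  rw [← ZMod.natCast_eq_zero_iff_even, ← ind_dotProduct_ind, ind_supp, ind_supp] at h2
  exact h2

/-- A strictly larger linear code contains a further coset of `C`. -/
lemma SelfDual.two_pow_le_card {k : ℕ} {C : Finset (Finset ι)} (h : SelfDual C k) {x : ι → Vec m}
    (hC : C ⊆ rel x) (hne : rel x ≠ C) : 2 ^ (k + 1) ≤ #(rel x) := by
  obtain ⟨s, hs, hsC⟩ := exists_of_ssubset (hC.ssubset_of_ne hne.symm)
  have hd : Disjoint C (C.image (symmDiff s)) := by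
    rw [disjoint_left]
    intro t ht ht'
    obtain ⟨u, hu, rfl⟩ := mem_image.1 ht'
    exact hsC ((h.symmDiff_mem_iff hu).1 ht)
  have hsub : C ∪ C.image (symmDiff s) ⊆ rel x := by
    refine union_subset hC fun t ht => ?_
    obtain ⟨u, hu, rfl⟩ := mem_image.1 ht
    have hs' := mem_rel.1 hs
    have hu' := mem_rel.1 (hC hu)
    refine mem_rel.2 ⟨?_, by rw [sum_symmDiff_vec, hs'.2, hu'.2, add_zero]⟩
    have h1 := card_symmDiff_add s u
    have h2 := hs'.1.add hu'.1
    rw [← h1] at h2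
    exact (Nat.even_add.1 h2).2 (even_two_mul _)
  have h1 := card_le_card hsub
  rw [card_union_of_disjoint hd, card_image_of_injective _ (symmDiff_right_injective s),
    h.card_eq] at h1
  rw [pow_succ]
  omega

end LinearAlgebra

/-! ### Sums over null tuples -/

lemma abs_sum_prod_le {ι V : Type*} [Fintype ι] {f : V → ℝ} (hf : ∀ v, f v ^ 2 = 1)
    (s : Finset (ι → V)) : |∑ x ∈ s, ∏ i, f (x i)| ≤ #s := by
  refine (abs_sum_le_sum_abs _ _).trans ?_
  rw [card_eq_sum_ones, Nat.cast_sum]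
  refine sum_le_sum fun x _ => ?_
  rw [abs_prod, prod_eq_one fun i _ => ?_]
  · simp
  · rw [← sq_eq_sq₀ (abs_nonneg _) zero_le_one, sq_abs, hf, one_pow]

open Classical in
/-- The sum of a product of signs over the injective null tuples of length at most fourteen is
not much smaller than zero. -/
lemma exists_le_sum_null (k : ℕ) (hk : k + 1 ≤ 7) : ∃ K : ℝ, 0 ≤ K ∧ ∀ (m : ℕ) (f : Vec m → ℝ),
    (∀ v, f v ^ 2 = 1) → -(K * (2 ^ m) ^ k) ≤
      ∑ x : Fin (2 * (k + 1)) → Vec m with Function.Injective x ∧ IsNull x, ∏ i, f (x i) := by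
  set N : ℝ := ((Fintype.card (Finset (Finset (Fin (2 * (k + 1))))) : ℕ) : ℝ) with hN
  have hN1 : 1 ≤ N := by
    rw [hN]; exact_mod_cast Fintype.card_pos
  refine ⟨N * N, by positivity, fun m f hf => ?_⟩
  have hcard : Fintype.card (Fin (2 * (k + 1))) = 2 * (k + 1) := Fintype.card_fin _
  have hp : (0 : ℝ) ≤ (2 ^ m) ^ k := by positivity
  have hD : ∀ D : Finset (Finset (Fin (2 * (k + 1)))), -(N * (2 ^ m) ^ k) ≤
      ∑ x ∈ {x : Fin (2 * (k + 1)) → Vec m | Function.Injective x ∧ IsNull x} with rel x = D,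
        ∏ i, f (x i) := by
    intro D
    -- For self-dual `D` the tuples with exactly the relations `D` are those obeying `D`, whose sum
    -- is nonnegative, minus those with more relations, at most `N * (2 ^ m) ^ k` in number. For
    -- other `D` the whole fibre has at most `(2 ^ m) ^ k` elements.
    by_cases hSD : SelfDual D (k + 1)
    · have hset : ({x ∈ ({x | Function.Injective x ∧ IsNull x} :
          Finset (Fin (2 * (k + 1)) → Vec m)) | rel x = D})
          = ({x | rel x = D} : Finset (Fin (2 * (k + 1)) → Vec m)) := by
        ext x
        simp only [mem_filter, mem_univ, true_and]
        refine ⟨fun h => h.2, fun h => ⟨?_, h⟩⟩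
        have hx : SelfDual (rel x) (k + 1) := by rwa [h]
        exact ⟨hx.injective, hx.isNull⟩
      rw [hset]
      have hpos := hSD.sum_prod_nonneg (hSD.reflective hk ⟨0, by omega⟩) f
      set A : Finset (Fin (2 * (k + 1)) → Vec m) := {x | D ⊆ rel x}
      have hsplit := sum_filter_add_sum_filter_not A (fun x => rel x = D) fun x => ∏ i, f (x i)
      have h1 : A.filter (fun x => rel x = D) = ({x | rel x = D} : Finset _) := by
        ext x
        simp only [A, mem_filter, mem_univ, true_and]
        exact ⟨fun h => h.2, fun h => ⟨h ▸ Subset.rfl, h⟩⟩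
      rw [h1] at hsplit
      have h2 := abs_sum_prod_le hf (A.filter fun x => ¬ rel x = D)
      have h3 : A.filter (fun x => ¬ rel x = D) ⊆
          ({E | 2 ^ (k + 2) ≤ #E} : Finset (Finset (Finset (Fin (2 * (k + 1)))))).biUnion
            fun E => ({x | E ⊆ rel x} : Finset (Fin (2 * (k + 1)) → Vec m)) := by
        intro x hx
        simp only [A, mem_filter, mem_univ, true_and] at hx
        simp only [mem_biUnion, mem_filter, mem_univ, true_and]
        exact ⟨rel x, hSD.two_pow_le_card hx.1 hx.2, Subset.rfl⟩
      have h4 : #(A.filter fun x => ¬ rel x = D) ≤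
          Fintype.card (Finset (Finset (Fin (2 * (k + 1))))) * (2 ^ m) ^ k := by
        refine (card_le_card h3).trans ((card_biUnion_le_card_mul _ _ ((2 ^ m) ^ k)
          fun E hE => ?_).trans (Nat.mul_le_mul_right _ (card_le_univ _)))
        exact card_filter_subset_rel_le hcard (mem_filter.1 hE).2
      have h5 : (#(A.filter fun x => ¬ rel x = D) : ℝ) ≤ N * (2 ^ m) ^ k := by
        rw [hN]; exact_mod_cast h4
      have h6 := le_abs_self (∑ x ∈ A.filter (fun x => ¬ rel x = D), ∏ i, f (x i))
      linarith
    · set A : Finset (Fin (2 * (k + 1)) → Vec m) :=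
        {x ∈ ({x | Function.Injective x ∧ IsNull x} : Finset (Fin (2 * (k + 1)) → Vec m)) |
          rel x = D}
      have h1 : #A ≤ (2 ^ m) ^ k := by
        rcases A.eq_empty_or_nonempty with hA | ⟨x, hx⟩
        · simp [hA]
        · have hx' := hx
          simp only [A, mem_filter, mem_univ, true_and] at hx'
          rcases selfDual_or_card_le hcard hx'.1.2 hx'.1.1 with h | h
          · rw [hx'.2] at h
            exact absurd h hSD
          · rw [hx'.2] at h
            refine (card_le_card fun y hy => ?_).trans (card_filter_subset_rel_le hcard h)
            simp only [A, mem_filter, mem_univ, true_and] at hy ⊢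
            rw [hy.2]
      have h2 : (#A : ℝ) ≤ (2 ^ m) ^ k := by exact_mod_cast h1
      have h3 := (abs_le.1 (abs_sum_prod_le hf A)).1
      have h4 : 1 * ((2 : ℝ) ^ m) ^ k ≤ N * (2 ^ m) ^ k := mul_le_mul_of_nonneg_right hN1 hp
      linarith
  rw [← sum_fiberwise _ (fun x => rel x)]
  refine le_trans ?_ (sum_le_sum fun D _ => hD D)
  rw [sum_const, card_univ, nsmul_eq_mul, ← hN]
  linarith

/-! ### Averaging over quadratic forms -/

/-- The sign attached to a bit. -/
def chi (a : ZMod 2) : ℝ := if a = 0 then 1 else -1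

lemma chi_add (a b : ZMod 2) : chi (a + b) = chi a * chi b := by
  rcases zmod_two_cases a with rfl | rfl <;> rcases zmod_two_cases b with rfl | rfl <;>
    simp [chi, CharTwo.add_self_eq_zero]

lemma chi_zero : chi 0 = 1 := by simp [chi]

lemma chi_one : chi 1 = -1 := by simp [chi]

lemma chi_sq (a : ZMod 2) : chi a ^ 2 = 1 := by
  rcases zmod_two_cases a with rfl | rfl <;> simp [chi]

lemma chi_sum {ι : Type*} (s : Finset ι) (a : ι → ZMod 2) :
    chi (∑ i ∈ s, a i) = ∏ i ∈ s, chi (a i) := by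
  classical
  induction s using Finset.induction_on with
  | empty => simp [chi_zero]
  | insert i s hi ih => rw [sum_insert hi, prod_insert hi, chi_add, ih]

/-- The quadratic form with matrix `M`. -/
def quad {m : ℕ} (M : Matrix (Fin m) (Fin m) (ZMod 2)) (v : Vec m) : ZMod 2 :=
  ∑ l, ∑ l', M l l' * (v l * v l')

lemma sum_quad {ι : Type*} [Fintype ι] {m : ℕ} (M : Matrix (Fin m) (Fin m) (ZMod 2))
    (x : ι → Vec m) : ∑ i, quad M (x i) = ∑ l, ∑ l', M l l' * ∑ i, x i l * x i l' := by
  unfold quad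
  rw [sum_comm]
  refine sum_congr rfl fun l _ => ?_
  rw [sum_comm]
  refine sum_congr rfl fun l' _ => ?_
  rw [mul_sum]

-- Character orthogonality: if the monomial with indices `a`, `b` has sum 1 over the tuple, adding
-- it to `M` flips the sign.
open Classical in
lemma sum_prod_chi_quad {ι : Type*} [Fintype ι] {m : ℕ} (x : ι → Vec m) :
    ∑ M : Matrix (Fin m) (Fin m) (ZMod 2), ∏ i, chi (quad M (x i))
      = if IsNull x then (Fintype.card (Matrix (Fin m) (Fin m) (ZMod 2)) : ℝ) else 0 := by
  simp only [← chi_sum, sum_quad]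
  split_ifs with hx
  · have h1 : ∀ M : Matrix (Fin m) (Fin m) (ZMod 2),
        ∑ l, ∑ l', M l l' * ∑ i, x i l * x i l' = 0 := fun M =>
      sum_eq_zero fun l _ => sum_eq_zero fun l' _ => by rw [hx l l', mul_zero]
    simp [h1, chi_zero]
  · unfold IsNull at hx
    push Not at hx
    obtain ⟨a, b, hab⟩ := hx
    have hab1 := (zmod_two_cases (∑ i, x i a * x i b)).resolve_left hab
    have h1 : ∀ M : Matrix (Fin m) (Fin m) (ZMod 2),
        chi (∑ l, ∑ l', (M + Matrix.single a b (1 : ZMod 2)) l l' * ∑ i, x i l * x i l')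
          = - chi (∑ l, ∑ l', M l l' * ∑ i, x i l * x i l') := by
      intro M
      simp only [Matrix.add_apply, add_mul, sum_add_distrib, chi_add]
      have : ∑ l, ∑ l', (Matrix.single a b (1 : ZMod 2)) l l' * ∑ i, x i l * x i l' = 1 := by
        rw [sum_eq_single a, sum_eq_single b, Matrix.single_apply_same, one_mul, hab1]
        · intro l _ hl
          rw [Matrix.single_apply_of_ne _ _ _ _ _ (fun h => hl h.2.symm), zero_mul]
        · simp
        · intro l _ hl
          refine sum_eq_zero fun l' _ => ?_
          rw [Matrix.single_apply_of_ne _ _ _ _ _ (fun h => hl h.1.symm), zero_mul]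
        · simp
      rw [this, chi_one]
      ring
    have h2 := Equiv.sum_comp (Equiv.addRight (Matrix.single a b (1 : ZMod 2)))
      fun M : Matrix (Fin m) (Fin m) (ZMod 2) =>
        chi (∑ l, ∑ l', M l l' * ∑ i, x i l * x i l')
    simp only [Equiv.coe_addRight] at h2
    simp only [h1, sum_neg_distrib] at h2
    linarith

open Classical in
/-- The average of an even Hermite-type sum over all quadratic forms. -/
lemma sum_hermitePair {m : ℕ} (f : Vec m → ℝ) (hf : ∀ v, f v ^ 2 = 1) (j : ℕ) :
    ∑ M : Matrix (Fin m) (Fin m) (ZMod 2),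
      (hermitePair ((∑ v, f v * chi (quad M v)) ^ 2 / 2 ^ m) (1 / 2 ^ m) j).1
      = Fintype.card (Matrix (Fin m) (Fin m) (ZMod 2))
        * (∑ x : Fin (2 * j) → Vec m with Function.Injective x ∧ IsNull x, ∏ i, f (x i))
        / (2 ^ m) ^ j := by
  have hc : (#(univ : Finset (Vec m)) : ℝ) = 2 ^ m := by simp [card_univ]
  have h1 : ∀ M : Matrix (Fin m) (Fin m) (ZMod 2),
      (hermitePair ((∑ v, f v * chi (quad M v)) ^ 2 / 2 ^ m) (1 / 2 ^ m) j).1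
        = (∑ x : Fin (2 * j) → Vec m with Function.Injective x,
          (∏ i, f (x i)) * ∏ i, chi (quad M (x i))) / (2 ^ m) ^ j := by
    intro M
    have h2 := hermitePair_eq (univ : Finset (Vec m)) univ_nonempty
      (fun v => f v * chi (quad M v)) (fun v => by rw [mul_pow, hf, chi_sq, one_mul]) j
    rw [hc] at h2
    rw [h2, ← sum_injective_prod]
    simp only [prod_mul_distrib]
  simp only [h1]
  rw [← sum_div, sum_comm]
  simp only [← mul_sum, sum_prod_chi_quad, mul_ite, mul_zero]
  rw [← sum_filter, filter_filter, ← sum_mul, mul_comm]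

/-- The covering radius bound for the second-order Reed-Muller code: each sign function has a
large inner product with some quadratic form. -/
theorem eventually_exists_quad : ∀ᶠ m : ℕ in Filter.atTop, ∀ f : Vec m → ℝ, (∀ v, f v ^ 2 = 1) →
    ∃ M : Matrix (Fin m) (Fin m) (ZMod 2), 15 * 2 ^ m < (∑ v, f v * chi (quad M v)) ^ 2 := by
  classical
  obtain ⟨e₀, he₀, htest⟩ := exists_testSum_le
  choose! K hK0 hK using exists_le_sum_null
  set B := 47304 * K 0 + 85320 * K 1 + 48036 * K 2 + 11244 * K 3 + 1206 * K 4 + 58 * K 5 + K 6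
    with hB
  have htend : Filter.Tendsto (fun m : ℕ => (2 : ℝ) ^ m) Filter.atTop Filter.atTop :=
    tendsto_pow_atTop_atTop_of_one_lt one_lt_two
  filter_upwards [htend.eventually_ge_atTop (1 / e₀), htend.eventually_ge_atTop B]
    with m hm1 hm2 f hf
  by_contra! hall
  have hn : (0 : ℝ) < 2 ^ m := by positivity
  set c : ℝ := ((Fintype.card (Matrix (Fin m) (Fin m) (ZMod 2)) : ℕ) : ℝ) with hc
  have hc0 : 0 < c := by rw [hc]; exact_mod_cast Fintype.card_pos
  have hup : ∑ M : Matrix (Fin m) (Fin m) (ZMod 2),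
      testSum ((∑ v, f v * chi (quad M v)) ^ 2 / 2 ^ m) (1 / 2 ^ m) ≤ c * 1000 := by
    refine (sum_le_sum fun M _ => htest _ (by positivity) ?_ _ (by positivity) ?_).trans ?_
    · rw [div_le_iff₀ hn]
      rwa [div_le_iff₀ he₀, mul_comm] at hm1
    · rw [div_le_iff₀ hn]
      exact hall M
    · rw [sum_const, card_univ, nsmul_eq_mul]
  have hlow : ∀ j, j + 1 ≤ 7 → -(c * (K j / 2 ^ m)) ≤ ∑ M : Matrix (Fin m) (Fin m) (ZMod 2),
      (hermitePair ((∑ v, f v * chi (quad M v)) ^ 2 / 2 ^ m) (1 / 2 ^ m) (j + 1)).1 := by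
    intro j hj
    rw [sum_hermitePair f hf, le_div_iff₀ (by positivity)]
    have h1 := mul_le_mul_of_nonneg_left (hK j hj m f hf) hc0.le
    refine le_trans (le_of_eq ?_) h1
    rw [pow_succ]
    field_simp
  unfold testSum at hup
  simp only [sum_add_distrib, ← mul_sum] at hup
  rw [sum_const, card_univ, nsmul_eq_mul, ← hc] at hup
  have h0 := hlow 0 (by norm_num)
  have h1 := hlow 1 (by norm_num)
  have h2 := hlow 2 (by norm_num)
  have h3 := hlow 3 (by norm_num)
  have h4 := hlow 4 (by norm_num)
  have h5 := hlow 5 (by norm_num)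
  have h6 := hlow 6 (by norm_num)
  -- `B` weights the error constants by the coefficients of `testSum`, so the total error per form
  -- is at most 1, and the average of `testSum` is at least `3024 - 1 > 1000`.
  have hBn : c * (B / 2 ^ m) ≤ c * 1 :=
    mul_le_mul_of_nonneg_left ((div_le_one hn).2 hm2) hc0.le
  have hBe : c * (B / 2 ^ m) = 47304 * (c * (K 0 / 2 ^ m)) + 85320 * (c * (K 1 / 2 ^ m))
      + 48036 * (c * (K 2 / 2 ^ m)) + 11244 * (c * (K 3 / 2 ^ m)) + 1206 * (c * (K 4 / 2 ^ m))
      + 58 * (c * (K 5 / 2 ^ m)) + c * (K 6 / 2 ^ m) := by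
    rw [hB]; ring
  norm_num only at hup h0 h1 h2 h3 h4 h5 h6
  linarith

/-! ### Correlation with polynomials of higher order -/

/-- Each sign function on binary `m`-tuples has inner product at least `c` with the signs of some
polynomial of degree at most `r`. -/
def Correlates (r m : ℕ) (c : ℝ) : Prop :=
  ∀ f : Vec m → ℝ, (∀ v, f v ^ 2 = 1) → ∃ p : MvPolynomial (Fin m) (ZMod 2),
    p.totalDegree ≤ r ∧ c ≤ ∑ v, f v * chi (MvPolynomial.eval v p)

lemma Correlates.mono {r m : ℕ} {c d : ℝ} (h : Correlates r m c) (hd : d ≤ c) :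
    Correlates r m d := fun f hf =>
  let ⟨p, hp, hpc⟩ := h f hf
  ⟨p, hp, hd.trans hpc⟩

/-- Adding the constant 1 to a polynomial negates the correlation without raising the degree bound.
-/
lemma correlates_of_abs {r m : ℕ} {c : ℝ} (h : ∀ f : Vec m → ℝ, (∀ v, f v ^ 2 = 1) →
    ∃ p : MvPolynomial (Fin m) (ZMod 2), p.totalDegree ≤ r ∧
      c ≤ |∑ v, f v * chi (MvPolynomial.eval v p)|) : Correlates r m c := by
  intro f hf
  obtain ⟨p, hp, hpc⟩ := h f hf
  rcases le_total 0 (∑ v, f v * chi (MvPolynomial.eval v p)) with h0 | h0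
  · exact ⟨p, hp, by rwa [abs_of_nonneg h0] at hpc⟩
  · refine ⟨p + 1, ?_, ?_⟩
    · refine (MvPolynomial.totalDegree_add _ _).trans ?_
      rw [MvPolynomial.totalDegree_one]
      exact max_le hp (Nat.zero_le _)
    · rw [abs_of_nonpos h0] at hpc
      simpa [chi_add, chi_one] using hpc

lemma correlates_zero (r m : ℕ) : Correlates r m 0 :=
  correlates_of_abs fun _ _ => ⟨0, by simp, abs_nonneg _⟩

/-- The Plotkin construction: choose `p` for `f` on the half where the first variable is 0, then `q`
for `f` times the sign of `p` on the other half, and take `p + x₀ q`. -/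
lemma Correlates.succ {r m : ℕ} {c d : ℝ} (hc : Correlates (r + 1) m c) (hd : Correlates r m d) :
    Correlates (r + 1) (m + 1) (c + d) := by
  intro f hf
  obtain ⟨p, hp, hpc⟩ := hc (fun v => f (Fin.cons 0 v)) fun v => hf _
  obtain ⟨q, hq, hqd⟩ := hd (fun v => f (Fin.cons 1 v) * chi (MvPolynomial.eval v p))
    fun v => by rw [mul_pow, hf, chi_sq, one_mul]
  refine ⟨MvPolynomial.rename Fin.succ p + MvPolynomial.X 0 * MvPolynomial.rename Fin.succ q,
    ?_, ?_⟩
  · refine (MvPolynomial.totalDegree_add _ _).trans (max_le ?_ ?_)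
    · exact (MvPolynomial.totalDegree_rename_le _ _).trans hp
    · refine (MvPolynomial.totalDegree_mul _ _).trans ?_
      rw [MvPolynomial.totalDegree_X, add_comm]
      exact Nat.add_le_add_right ((MvPolynomial.totalDegree_rename_le _ _).trans hq) 1
  · have heval : ∀ (a : ZMod 2) (v : Vec m), MvPolynomial.eval (Fin.cons a v : Vec (m + 1))
        (MvPolynomial.rename Fin.succ p + MvPolynomial.X 0 * MvPolynomial.rename Fin.succ q)
        = MvPolynomial.eval v p + a * MvPolynomial.eval v q := by
      intro a v
      have hcomp : (Fin.cons a v : Vec (m + 1)) ∘ Fin.succ = v := by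
        funext i; simp
      simp [MvPolynomial.eval_rename, hcomp]
    have hsum : ∀ g : Vec (m + 1) → ℝ,
        ∑ u, g u = ∑ v : Vec m, g (Fin.cons 0 v) + ∑ v : Vec m, g (Fin.cons 1 v) := by
      intro g
      rw [← (Fin.consEquiv fun _ : Fin (m + 1) => ZMod 2).sum_comp, Fintype.sum_prod_type]
      exact Fin.sum_univ_two _
    rw [hsum]
    simp only [heval, zero_mul, add_zero, one_mul, chi_add]
    refine add_le_add hpc (hqd.trans_eq (sum_congr rfl fun v _ => ?_))
    ring

lemma eventually_correlates_two :
    ∀ᶠ m : ℕ in Filter.atTop, Correlates 2 m (√15 * √2 ^ m) := by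
  filter_upwards [eventually_exists_quad] with m hm
  refine correlates_of_abs fun f hf => ?_
  obtain ⟨M, hM⟩ := hm f hf
  refine ⟨∑ l, ∑ l', MvPolynomial.C (M l l') * (MvPolynomial.X l * MvPolynomial.X l'), ?_, ?_⟩
  · refine MvPolynomial.totalDegree_finsetSum_le fun l _ =>
      MvPolynomial.totalDegree_finsetSum_le fun l' _ => ?_
    refine (MvPolynomial.totalDegree_mul _ _).trans ?_
    rw [MvPolynomial.totalDegree_C, zero_add]
    refine (MvPolynomial.totalDegree_mul _ _).trans ?_
    rw [MvPolynomial.totalDegree_X, MvPolynomial.totalDegree_X]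
  · have heval : ∀ v : Vec m, MvPolynomial.eval v (∑ l, ∑ l', MvPolynomial.C (M l l') *
        (MvPolynomial.X l * MvPolynomial.X l')) = quad M v := by
      intro v
      simp [quad]
    simp only [heval]
    refine abs_le_of_sq_le_sq' ?_ (abs_nonneg _) |>.2
    rw [sq_abs, mul_pow, Real.sq_sqrt (by norm_num), ← pow_mul, mul_comm m 2, pow_mul,
      Real.sq_sqrt (by norm_num)]
    exact hM.le

lemma eventually_correlates_succ {r : ℕ} {t : ℝ}
    (h : ∀ L < t, ∀ᶠ m : ℕ in Filter.atTop, Correlates r m (L * √2 ^ m)) :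
    ∀ L < t * (√2 + 1), ∀ᶠ m : ℕ in Filter.atTop, Correlates (r + 1) m (L * √2 ^ m) := by
  intro L hL
  have h2 : √2 * √2 = 2 := Real.mul_self_sqrt (by norm_num)
  have hs : 0 < √2 + 1 := by positivity
  obtain ⟨L', hL1, hL2⟩ := exists_between ((div_lt_iff₀ hs).2 hL)
  rw [div_lt_iff₀ hs] at hL1
  obtain ⟨m₀, hm₀⟩ := Filter.eventually_atTop.1 (h L' hL2)
  -- Summing the geometric series from the trivial bound 0 at `m₀`; the factor comes from `(√2 +
  -- 1)(√2 - 1) = 1`.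
  have hk : ∀ k : ℕ, Correlates (r + 1) (m₀ + k) (L' * (√2 + 1) * (√2 ^ (m₀ + k) - √2 ^ m₀)) := by
    intro k
    induction k with
    | zero => simpa using correlates_zero _ _
    | succ k ih =>
      refine (ih.succ (hm₀ (m₀ + k) (by omega))).mono (le_of_eq ?_)
      rw [← add_assoc, pow_succ]
      linear_combination (L' * √2 ^ (m₀ + k)) * h2
  have htend : Filter.Tendsto (fun m : ℕ => √2 ^ m) Filter.atTop Filter.atTop :=
    tendsto_pow_atTop_atTop_of_one_lt Real.one_lt_sqrt_two
  filter_upwards [htend.eventually_ge_atTop (L' * (√2 + 1) * √2 ^ m₀ / (L' * (√2 + 1) - L)),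
    Filter.eventually_ge_atTop m₀] with m hm hm'
  obtain ⟨k, rfl⟩ := Nat.exists_eq_add_of_le hm'
  refine (hk k).mono ?_
  rw [div_le_iff₀ (by linarith)] at hm
  linarith

lemma eventually_correlates (r : ℕ) : ∀ L < √15 * (√2 + 1) ^ r,
    ∀ᶠ m : ℕ in Filter.atTop, Correlates (r + 2) m (L * √2 ^ m) := by
  induction r with
  | zero =>
    intro L hL
    filter_upwards [eventually_correlates_two] with m hm
    refine hm.mono (mul_le_mul_of_nonneg_right ?_ (by positivity))
    simpa using hL.le
  | succ r ih =>
    rw [pow_succ, ← mul_assoc]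
    exact eventually_correlates_succ ih

/-! ### From correlation to PMEPR -/

lemma binaryPoint_bijective (m : ℕ) : Function.Bijective (binaryPoint m) := by
  rw [Fintype.bijective_iff_injective_and_card]
  refine ⟨fun i j hij => Fin.ext (Nat.eq_of_testBit_eq fun k => ?_), by simp [ZMod.card]⟩
  by_cases hk : k < m
  · have h := congrFun hij ⟨k, hk⟩
    simp only [binaryPoint] at h
    cases hi : (i : ℕ).testBit k <;> cases hj : (j : ℕ).testBit k <;> simp [hi, hj] at h ⊢
  · have h : ∀ i : Fin (2 ^ m), (i : ℕ).testBit k = false := fun i =>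
      Nat.testBit_lt_two_pow (i.2.trans_le (Nat.pow_le_pow_right (by norm_num) (by omega)))
    rw [h i, h j]

lemma psk_one {n : ℕ} (c : Fin n → ZMod (2 ^ 1)) (i : Fin n) :
    psk 1 c i = (chi (c i : ZMod 2) : ℂ) := by
  have h : ∀ a : ZMod (2 ^ 1), a = 0 ∨ a = 1 := zmod_two_cases
  unfold psk
  rcases h (c i) with h0 | h0 <;> rw [h0]
  · have : (chi (0 : ZMod (2 ^ 1)) : ℝ) = 1 := chi_zero
    rw [this]
    simp
  · have h1 : (chi (1 : ZMod (2 ^ 1)) : ℝ) = -1 := chi_one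
    have h2 : (1 : ZMod (2 ^ 1)).val = 1 := rfl
    rw [h1, h2]
    push_cast
    rw [← Complex.exp_pi_mul_I]
    congr 1
    ring

lemma chi_shiftedWord {n : ℕ} (σ : Equiv.Perm (Fin n)) (w : Fin n → ZMod (2 ^ 1))
    (b : Fin n → ZMod 2) (i : Fin n) :
    chi (shiftedWord 1 σ w b i : ZMod 2) = chi (b (σ i)) * chi (w i : ZMod 2) := by
  have h : (shiftedWord 1 σ w b i : ZMod 2) = b (σ i) + (w i : ZMod 2) := by
    have h1 : ∀ a c : ZMod 2, ((2 : ZMod (2 ^ 1)) ^ (1 - 1) * ((a.val : ℕ) : ZMod (2 ^ 1))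
        + (c : ZMod (2 ^ 1)) : ZMod (2 ^ 1)) = (a + c : ZMod 2) := by decide
    exact h1 _ _
  rw [h, chi_add]

/-- Evaluation at `θ = 0`, where `ζ` plays no role; continuity on a compact interval bounds the
supremum. -/
lemma le_pmepr (ζ : ℝ) (h : ℕ) {n : ℕ} (c : Fin n → ZMod (2 ^ h)) :
    1 / (n : ℝ) * ‖∑ i, psk h c i‖ ^ 2 ≤ pmepr ζ h c := by
  unfold pmepr
  refine mul_le_mul_of_nonneg_left (le_csSup ?_ ?_) (by positivity)
  · have hcont : Continuous fun θ : ℝ => ‖envelope ζ h c θ‖ ^ 2 := by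
      unfold envelope
      fun_prop
    exact (isCompact_Icc.bddAbove_image hcont.continuousOn).mono
      (Set.image_mono Set.Ico_subset_Icc_self)
  · refine ⟨0, ⟨le_rfl, zero_lt_one⟩, ?_⟩
    simp [envelope]

lemma Correlates.le_minPMEPR {r m : ℕ} {c : ℝ} (hc : Correlates r m c) (hc0 : 0 ≤ c) (ζ : ℝ) :
    c ^ 2 / 2 ^ m ≤ minPMEPR ζ 1 (reedMuller r m) := by
  unfold minPMEPR
  refine le_csInf ⟨_, Set.mem_image_of_mem _ ⟨1, 0, rfl⟩⟩ ?_
  rintro _ ⟨_, ⟨σ, w, rfl⟩, rfl⟩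
  set β := Equiv.ofBijective _ (binaryPoint_bijective m) with hβ
  -- The sign function is that of the offset, carried back to points through `σ` and the
  -- enumeration.
  obtain ⟨p, hp, hpc⟩ := hc (fun v => chi (w (σ.symm (β.symm v)) : ZMod 2)) fun v => chi_sq _
  set b : Fin (2 ^ m) → ZMod 2 := fun i => MvPolynomial.eval (binaryPoint m i) p with hb
  have hbmem : b ∈ reedMuller r m := ⟨p, hp, fun i => rfl⟩
  have hsum : ∑ i, psk 1 (shiftedWord 1 σ w b) i
      = ((∑ v, chi (w (σ.symm (β.symm v)) : ZMod 2) * chi (MvPolynomial.eval v p) : ℝ) : ℂ) := by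
    simp only [psk_one, chi_shiftedWord]
    rw [← Complex.ofReal_sum]
    congr 1
    rw [← (σ.trans β).sum_comp]
    refine sum_congr rfl fun i _ => ?_
    simp [hb, hβ, mul_comm]
  have h1 := le_pmepr ζ 1 (shiftedWord 1 σ w b)
  refine le_trans ?_ (le_csSup (Set.toFinite _).bddAbove
    (Set.mem_image_of_mem _ (Set.mem_image_of_mem _ hbmem)))
  refine le_trans ?_ h1
  rw [hsum, Complex.norm_real, Real.norm_eq_abs, sq_abs, div_eq_mul_one_div, mul_comm]
  push_cast
  exact mul_le_mul_of_nonneg_left (pow_le_pow_left₀ hc0 hpc 2) (by positivity)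

end OFDM

end

theorem mainTheorem9 (ζ : ℝ) (hζ : 0 < ζ) (r : ℕ) (hr : 1 < r) :
    ((15 * (Real.sqrt 2 + 1) ^ (2 * r - 4) : ℝ) : EReal) ≤
      Filter.liminf (fun m : ℕ => ((OFDM.minPMEPR ζ 1 (OFDM.reedMuller r m) : ℝ) : EReal))
        Filter.atTop := by
  obtain ⟨r, rfl⟩ : ∃ s, r = s + 2 := ⟨r - 2, by omega⟩
  set t : ℝ := √15 * (√2 + 1) ^ r with ht
  have ht0 : 0 < t := by positivity
  have ht2 : (15 * (Real.sqrt 2 + 1) ^ (2 * (r + 2) - 4) : ℝ) = t ^ 2 := by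
    rw [ht, mul_pow, Real.sq_sqrt (by norm_num), ← pow_mul,
      show 2 * (r + 2) - 4 = r * 2 by omega]
  rw [ht2]
  have htend : Filter.Tendsto (fun L : ℝ => ((L ^ 2 : ℝ) : EReal)) (nhdsWithin t (Set.Iio t))
      (nhds ((t ^ 2 : ℝ) : EReal)) := by
    have hcont : Continuous fun L : ℝ => ((L ^ 2 : ℝ) : EReal) :=
      continuous_coe_real_ereal.comp (continuous_pow 2)
    exact (hcont.tendsto t).mono_left nhdsWithin_le_nhds
  -- The correlation bound holds only for `L < t`, so the liminf is bounded by `L ^ 2` and then `L`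
  -- tends to `t` from below.
  refine le_of_tendsto htend ?_
  filter_upwards [Ioo_mem_nhdsLT ht0] with L hL
  refine Filter.le_liminf_of_le (by isBoundedDefault) ?_
  filter_upwards [OFDM.eventually_correlates r L hL.2] with m hm
  rw [EReal.coe_le_coe_iff]
  have h := hm.le_minPMEPR (mul_nonneg hL.1.le (by positivity)) ζ
  rwa [mul_pow, ← pow_mul, mul_comm m 2, pow_mul, Real.sq_sqrt (by norm_num),
    mul_div_assoc, div_self (by positivity), mul_one] at h
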